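/- **Setting.** Let $\Omega\subset\mathbb R^d$ be non-empty, open and bounded, $T>0$, $\Omega_T:=\Omega\times(0,T)$, and let $\alpha<0<\beta$ and $\mu>0$ be real constants. Write $\|f\|:=\|f\|_{L^2(0,T)}$, $\langle\cdot,\cdot\rangle$ for the inner product of $L^2(\Omega_T)$, and, for $u\in L^2(\Omega_T)$, $$U_{ad}:=\{u\in L^2(\Omega_T):\alpha\le u\le\beta\text{ a.e.}\},\quad j_3(u):=\int_\Omega\|u(x,\cdot)\|\,dx,\quad G_3:=\delta_{U_{ad}}+\mu j_3:L^2(\Omega_T)\to(-\infty,\infty],$$ where $\delta_{U_{ad}}$ is $0$ on $U_{ad}$ and $\infty$ elsewhere. Fix $\bar u\in U_{ad}$ and let $F:U_{ad}\to\mathbb R$, $F'(\bar u)\in L^2(\Omega_T)$ and a bounded bilinear form $F''(\bar u)$ on $L^2(\Omega_T)$ satisfy $$\lim_{k\to\infty}\frac{F(\bar u+t_kh_k)-F(\bar u)-t_k\langle F'(\bar u),h_k\rangle-\tfrac12t_k^2F''(\bar u)(h_k,h_k)}{t_k^2}=0$$ whenever $t_k\searrow0$, $h_k\rightharpoonup h$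 in $L^2(\Omega_T)$ and $\bar u+t_kh_k\in U_{ad}$. Here $t_k\searrow 0$ means $t_k>0$ and $t_k\to0$. Let $\partial G_3$ be the subdifferential of convex analysis. For $w,v\in L^2(\Omega_T)$, the weak second subderivative is $$G_3''(\bar u,w;v):=\inf\Big\{\liminf_{k\to\infty}\frac{G_3(\bar u+t_kv_k)-G_3(\bar u)-t_k\langle w,v_k\rangle}{t_k^2/2}\ :\ t_k\searrow0,\ v_k\rightharpoonup v\Big\}.$$ The functional $G_3$ is *strongly twice epi-differentiable* at $\bar u$ for $w$ if for every $v\in L^2(\Omega_T)$ and every sequence $t_k\searrow0$ there are $v_k\to v$ in $L^2(\Omega_T)$ such that the above quotients converge in $[-\infty,\infty]$ to $G_3''(\bar u,w;v)$. With $\mathcal T(\bar u)$ the tangent cone (in the sense of convex analysis) of $U_{ad}$ at $\bar u$, i.e. the closure of $\{v:\bar u+tv\in U_{ad}\text{ for some }t>0\}$, and $j_3'(\bar u;v)$ the one-sided directional derivative, the critical cone is $$C_{\bar u}:=\{v\in\mathcal T(\bar u):\langle F'(\bar u),v\rangle+\mu j_3'(\bar u;v)=0\}.$$ Finally, $\Omega_{\bar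 u}:=\{x\in\Omega:\|\bar u(x,\cdot)\|\ne0\}$. **Theorem.** Assume $-F'(\bar u)\in\partial G_3(\bar u)\cap L^\infty(\Omega_T)$. Then for every $v\in C_{\bar u}$ $$G_3''(\bar u,-F'(\bar u);v)=\begin{cases}\displaystyle\int_{\Omega_{\bar u}}\frac{\mu}{\|\bar u(x,\cdot)\|}\Big[\int_0^Tv(x,t)^2\,dt-\Big(\int_0^T\frac{\bar u(x,t)v(x,t)}{\|\bar u(x,\cdot)\|}\,dt\Big)^2\Big]dx,&\bar u\ne0,\\[2ex]0,&\bar u=0,\end{cases}$$ where the integral over $\Omega_{\bar u}$ of the (a.e. nonnegative) integrand takes values in $[0,\infty]$. Moreover, $G_3$ is strongly twice epi-differentiable at $\bar u$ for $-F'(\bar u)$. -/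

import Mathlib

open MeasureTheory Filter Topology
open scoped ENNReal

noncomputable section

namespace SparseControl

section Abstract

variable {X : Type*} [NormedAddCommGroup X] [InnerProductSpace ℝ X]

/-- Weak sequential convergence `h_k ⇀ h`, tested with all bounded linear functionals. -/
def WeakConv (h : ℕ → X) (h₀ : X) : Prop :=
  ∀ φ : X →L[ℝ] ℝ, Tendsto (fun k => φ (h k)) atTop (𝓝 (φ h₀))

/-- `t_k ↘ 0`: a sequence of positive reals converging to zero. -/
def StepsToZero (t : ℕ → ℝ) : Prop :=
  (∀ k, 0 < t k) ∧ Tendsto t atTop (𝓝 0)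

/-- The second-order difference quotient
`(G (x + t h) - G x - t ⟨w, h⟩) / (t² / 2)`, for a functional with values in `(-∞, ∞]`
and a point `x` of its domain. The dual pairing is the inner product. -/
def secondQuotient (G : X → EReal) (x w : X) (t : ℝ) (h : X) : EReal :=
  (G (x + t • h) - G x - ((t * inner ℝ w h : ℝ) : EReal)) / ((t ^ 2 / 2 : ℝ) : EReal)

/-- The weak second subderivative `G''(x, w; h)`. -/
def secondSubderiv (G : X → EReal) (x w h : X) : EReal :=
  sInf {q : EReal | ∃ (t : ℕ → ℝ) (hs : ℕ → X), StepsToZero t ∧ WeakConv hs h ∧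
    q = liminf (fun k => secondQuotient G x w (t k) (hs k)) atTop}

/-- Strong twice epi-differentiability of `G` at `x` for `w` in the direction `h`: each
sequence `t_k ↘ 0` admits a strongly convergent recovery sequence. -/
def StronglyTwiceEpiDiffInDir (G : X → EReal) (x w h : X) : Prop :=
  ∀ t : ℕ → ℝ, StepsToZero t → ∃ hs : ℕ → X, Tendsto hs atTop (𝓝 h) ∧
    Tendsto (fun k => secondQuotient G x w (t k) (hs k)) atTop (𝓝 (secondSubderiv G x w h))

/-- Strong twice epi-differentiability of `G` at `x` for `w`, in all directions. -/
def StronglyTwiceEpiDiff (G : X → EReal) (x w : X) : Prop :=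
  ∀ h : X, StronglyTwiceEpiDiffInDir G x w h

/-- The subdifferential of convex analysis. -/
def subdiff (G : X → EReal) (x : X) : Set X :=
  {w | ∀ y : X, G x + ((inner ℝ w (y - x) : ℝ) : EReal) ≤ G y}

/-- The tangent cone of convex analysis: the closure of the cone of feasible directions. -/
def convexTangentCone (U : Set X) (x : X) : Set X :=
  closure {v | ∃ t : ℝ, 0 < t ∧ x + t • v ∈ U}

/-- `d` is the (one-sided) directional derivative `j'(x; v)`. -/
def HasDirDeriv (j : X → ℝ) (x v : X) (d : ℝ) : Prop :=
  Tendsto (fun t : ℝ => (j (x + t • v) - j x) / t) (𝓝[>] 0) (𝓝 d)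

/-- The second-order Taylor-like expansion of `F` at `x` along weakly convergent directions
that stay in the set `U`, with gradient `F'` and second derivative `F''`. Only the values of `F`
on `U` (and at `x`) matter. -/
def HasTaylorExpansion (U : Set X) (F : X → ℝ) (x F' : X) (F'' : X →L[ℝ] X →L[ℝ] ℝ) : Prop :=
  ∀ (t : ℕ → ℝ) (hs : ℕ → X) (h : X), StepsToZero t → WeakConv hs h →
    (∀ k, x + t k • hs k ∈ U) →
    Tendsto (fun k => (F (x + t k • hs k) - F x - t k * inner ℝ F' (hs k)
      - (1 / 2) * t k ^ 2 * F'' (hs k) (hs k)) / t k ^ 2) atTop (𝓝 0)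

end Abstract

section Concrete

variable {d : ℕ}

/-- Lebesgue measure on the cylinder `Ω × (0, T)`. -/
abbrev cylMeasure (Ω : Set (EuclideanSpace ℝ (Fin d))) (T : ℝ) :
    Measure (EuclideanSpace ℝ (Fin d) × ℝ) :=
  (volume.restrict Ω).prod (volume.restrict (Set.Ioo 0 T))

/-- The Hilbert space `L²(Ω × (0, T))`. -/
abbrev L2 (Ω : Set (EuclideanSpace ℝ (Fin d))) (T : ℝ) : Type :=
  Lp ℝ 2 (cylMeasure Ω T)

variable {Ω : Set (EuclideanSpace ℝ (Fin d))} {T : ℝ}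

/-- `‖u(x)‖_{L²(0,T)}`. -/
def sliceNorm (u : L2 Ω T) (x : EuclideanSpace ℝ (Fin d)) : ℝ :=
  Real.sqrt (∫ t in Set.Ioo 0 T, (u (x, t)) ^ 2)

/-- `j₃(u) = ∫_Ω ‖u(x)‖_{L²(0,T)} dx`. -/
def j₃ (u : L2 Ω T) : ℝ :=
  ∫ x in Ω, sliceNorm u x

/-- The feasible set `{u | α ≤ u ≤ β a.e.}`. -/
def Uad (Ω : Set (EuclideanSpace ℝ (Fin d))) (T α β : ℝ) : Set (L2 Ω T) :=
  {u | ∀ᵐ p ∂(cylMeasure Ω T), α ≤ u p ∧ u p ≤ β}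

open Classical in
/-- `G₃ = δ_{Uad} + μ j₃`, with `δ` the indicator function with values `0` and `∞`. -/
def G₃ (α β μ : ℝ) (u : L2 Ω T) : EReal :=
  (if u ∈ Uad Ω T α β then (0 : EReal) else ⊤) + ((μ * j₃ u : ℝ) : EReal)

/-- The set `Ω_u` of the points `x ∈ Ω` with `‖u(x)‖ ≠ 0`. -/
def activeSet (u : L2 Ω T) : Set (EuclideanSpace ℝ (Fin d)) :=
  {x | x ∈ Ω ∧ sliceNorm u x ≠ 0}

/-- The critical cone at `u`: the tangent directions `v` of the feasible set with
`F'(u) v + μ j₃'(u; v) = 0`; the argument `F'` is the gradient of `F` at `u`. -/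
def criticalCone (α β μ : ℝ) (u F' : L2 Ω T) : Set (L2 Ω T) :=
  {v | v ∈ convexTangentCone (Uad Ω T α β) u ∧
    ∃ δ : ℝ, HasDirDeriv j₃ u v δ ∧ inner ℝ F' v + μ * δ = 0}

/-- The integrand `(μ / ‖u(x)‖) [∫ v² dt - (∫ u v / ‖u(x)‖ dt)²]`. -/
def curvIntegrand (μ : ℝ) (u v : L2 Ω T) (x : EuclideanSpace ℝ (Fin d)) : ℝ :=
  μ / sliceNorm u x * ((∫ t in Set.Ioo 0 T, (v (x, t)) ^ 2)
    - (∫ t in Set.Ioo 0 T, u (x, t) * v (x, t) / sliceNorm u x) ^ 2)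

/-- The integral of `curvIntegrand` over `Ω_u`, with values in `[0, ∞]`. By the Cauchy-Schwarz
inequality the integrand is nonnegative for almost every `x ∈ Ω_u`, so that nothing is cut off
by `ENNReal.ofReal`. -/
def curvature (μ : ℝ) (u v : L2 Ω T) : ℝ≥0∞ :=
  ∫⁻ x in activeSet u, ENNReal.ofReal (curvIntegrand μ u v x)

end Concrete

end SparseControl

end

open SparseControl

/-!
Write `a = u(x, ·)`, `h = v(x, ·)` for slices in `H = L²(0, T)`, and `w = -F'`. Everything rests on
two facts about the norm of a Hilbert space: its one-sided derivative `normDeriv a h`, which is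
linear in `h` for `a ≠ 0` and equal to `‖h‖` for `a = 0`, and two-sided bounds for the remainder
`‖a + t h‖ - ‖a‖ - t normDeriv a h` by `t² / 2` times the quadratic form `curvForm a`. They follow
from the identity `norm_remainder_mul`, which computes the remainder times its conjugate.

Integration over `x` gives the derivative `dirDeriv u v` of `j₃`, and the subgradient inequality
becomes `⟨w, v⟩ ≤ μ dirDeriv u v` for tangent directions `v` (`inner_le_dirDeriv`), with equality
exactly in critical directions. For feasible directions the second-order quotient is therefore the
sum of a nonnegative first-order term, divided by `t / 2`, and of the scaled remainder of `μ j₃`.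

* If the quotients stay bounded along a subsequence, the first-order term tends to zero, and since
  it is convex and continuous in the direction, hence weakly lower semicontinuous, the weak limit
  is critical (`critical_of_frequently_le`). So the subderivative is `∞` in noncritical directions.
* The remainder has minorants that are affine in the direction up to `O(t)` (`remainder_lower`):
  on sets where `‖a‖` is bounded below and `‖h‖` above, the quadratic form is linearized at the weak
  limit. Passing to the weak limit and exhausting `Ω_u` shows that the curvature is a lower bound
  (`curvature_le_liminf`).
* A critical direction of finite curvature is approximated by truncations of itself
  (`approximate_recovery`). The first-order term is additive over sets that do not split slices on
  which `u` vanishes, so the truncations stay critical (`inner_cut_eq`). Where `u` vanishes, equality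
  in the Cauchy-Schwarz inequality makes `v(x, ·)` a nonnegative multiple of `w(x, ·)`
  (`ae_eq_smul_subgradient`), so that boundedness of `w` makes whole truncated slices feasible.
  Choosing the truncation along the steps (`exists_recovery`) gives the recovery sequence.
-/

namespace SparseControl

/-! ### The norm of a Hilbert space: directional derivative and curvature -/

section Pointwise

variable {H : Type*} [NormedAddCommGroup H] [InnerProductSpace ℝ H]

open Classical in
/-- The directional derivative of the norm at `a` in the direction `h`. The first summand vanishes
for `a = 0` because of `0 / 0 = 0`. -/
noncomputable def normDeriv (a h : H) : ℝ :=
  inner ℝ a h / ‖a‖ + if a = 0 then ‖h‖ else 0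

/-- The second derivative of the norm at `a ≠ 0` as a bilinear form; it is `0` for `a = 0`. -/
noncomputable def curvForm (a h k : H) : ℝ :=
  (inner ℝ h k - inner ℝ a h * inner ℝ a k / ‖a‖ ^ 2) / ‖a‖

theorem normDeriv_zero_left (h : H) : normDeriv 0 h = ‖h‖ := by simp [normDeriv]

theorem normDeriv_of_ne {a : H} (ha : a ≠ 0) (h : H) : normDeriv a h = inner ℝ a h / ‖a‖ := by
  simp [normDeriv, ha]

theorem normDeriv_zero_right (a : H) : normDeriv a 0 = 0 := by
  simp [normDeriv]

theorem normDeriv_add_le (a h k : H) : normDeriv a (h + k) ≤ normDeriv a h + normDeriv a k := by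
  by_cases ha : a = 0
  · subst ha; simpa [normDeriv_zero_left] using norm_add_le h k
  · simp [normDeriv_of_ne ha, inner_add_right, add_div]

theorem normDeriv_add_of_zero {a h k : H} (hz : a = 0 → h = 0 ∨ k = 0) :
    normDeriv a (h + k) = normDeriv a h + normDeriv a k := by
  by_cases ha : a = 0
  · rcases hz ha with rfl | rfl <;> simp [normDeriv_zero_right]
  · simp [normDeriv_of_ne ha, inner_add_right, add_div]

theorem normDeriv_smul {c : ℝ} (hc : 0 ≤ c) (a h : H) :
    normDeriv a (c • h) = c * normDeriv a h := by
  by_cases ha : a = 0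
  · subst ha; simp [normDeriv_zero_left, norm_smul, abs_of_nonneg hc]
  · simp [normDeriv_of_ne ha, inner_smul_right, mul_div_assoc]

theorem abs_normDeriv_le (a h : H) : |normDeriv a h| ≤ ‖h‖ := by
  by_cases ha : a = 0
  · subst ha; simp [normDeriv_zero_left]
  · rw [normDeriv_of_ne ha, abs_div, abs_norm]
    have := norm_pos_iff.2 ha
    rw [div_le_iff₀ this, mul_comm]
    exact abs_real_inner_le_norm a h

theorem curvForm_zero_left (h k : H) : curvForm 0 h k = 0 := by simp [curvForm]

theorem curvForm_add_left (a h h' k : H) :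
    curvForm a (h + h') k = curvForm a h k + curvForm a h' k := by
  simp only [curvForm, inner_add_left, inner_add_right]; ring

theorem curvForm_smul_left (c : ℝ) (a h k : H) : curvForm a (c • h) k = c * curvForm a h k := by
  simp only [curvForm, inner_smul_left, inner_smul_right]
  simp only [conj_trivial]; ring

theorem curvForm_zero_zero (a : H) : curvForm a 0 0 = 0 := by simp [curvForm]

theorem curvForm_self_nonneg (a h : H) : 0 ≤ curvForm a h h := by
  by_cases ha : a = 0
  · simp [ha, curvForm_zero_left]
  have hA := norm_pos_iff.2 ha
  refine div_nonneg ?_ hA.le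
  rw [sub_nonneg, div_le_iff₀ (by positivity), real_inner_self_eq_norm_sq]
  have := abs_real_inner_le_norm a h
  nlinarith [abs_mul_abs_self (inner ℝ a h : ℝ), abs_nonneg (inner ℝ a h : ℝ), norm_nonneg h]

theorem curvForm_self_le (a h : H) : curvForm a h h ≤ ‖h‖ ^ 2 / ‖a‖ := by
  refine div_le_div_of_nonneg_right ?_ (norm_nonneg a)
  rw [real_inner_self_eq_norm_sq, sub_le_self_iff]
  exact div_nonneg (mul_self_nonneg _) (by positivity)

theorem abs_curvForm_le (a h k : H) : |curvForm a h k| ≤ 2 * (‖h‖ * ‖k‖) / ‖a‖ := by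
  by_cases ha : a = 0
  · simp [ha, curvForm_zero_left]
  have hA := norm_pos_iff.2 ha
  rw [curvForm, abs_div, abs_norm]
  refine div_le_div_of_nonneg_right ?_ hA.le
  have h1 := abs_real_inner_le_norm h k
  have h2 : |(inner ℝ a h * inner ℝ a k / ‖a‖ ^ 2 : ℝ)| ≤ ‖h‖ * ‖k‖ := by
    rw [abs_div, abs_mul, abs_of_pos (by positivity : 0 < ‖a‖ ^ 2), div_le_iff₀ (by positivity)]
    calc _ ≤ (‖a‖ * ‖h‖) * (‖a‖ * ‖k‖) := by
            gcongr <;> exact abs_real_inner_le_norm _ _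
      _ = _ := by ring
  linarith [abs_sub (inner ℝ h k : ℝ) (inner ℝ a h * inner ℝ a k / ‖a‖ ^ 2)]

/-- The Cauchy-Schwarz inequality for `curvForm a`, in the form that linearizes the square. -/
theorem curvForm_linearize (a h k : H) (c : ℝ) :
    2 * c * curvForm a h k - c ^ 2 * curvForm a k k ≤ curvForm a h h := by
  have := curvForm_self_nonneg a (h - c • k)
  have e : curvForm a (h - c • k) (h - c • k)
      = curvForm a h h - 2 * c * curvForm a h k + c ^ 2 * curvForm a k k := by
    simp only [curvForm, inner_sub_left, inner_sub_right, inner_smul_left, inner_smul_right,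
      conj_trivial, real_inner_comm h k]
    ring
  linarith

/-- Young's inequality for `curvForm a`. -/
theorem curvForm_add_self_le (a h k : H) {δ : ℝ} (hδ : 0 < δ) :
    curvForm a (h + k) (h + k) ≤ (1 + δ) * curvForm a h h + (1 + 1 / δ) * curvForm a k k := by
  have h1 := curvForm_linearize a h k (1 / δ)
  have e : curvForm a (h + k) (h + k)
      = curvForm a h h + 2 * curvForm a h k + curvForm a k k := by
    simp only [curvForm, inner_add_left, inner_add_right, real_inner_comm h k]
    ring
  have h2 := mul_le_mul_of_nonneg_left h1 hδ.le
  have h3 : δ * (2 * (1 / δ) * curvForm a h k - (1 / δ) ^ 2 * curvForm a k k)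
      = 2 * curvForm a h k - 1 / δ * curvForm a k k := by
    field_simp
  rw [h3] at h2
  rw [e]; linarith

/-- The remainder `‖a + t h‖ - q`, with `q` the first-order expansion of the norm, multiplied
by its conjugate `‖a + t h‖ + q`. -/
theorem norm_remainder_mul {a : H} (ha : a ≠ 0) (h : H) (t : ℝ) :
    (‖a + t • h‖ - (‖a‖ + t * (inner ℝ a h / ‖a‖)))
      * (‖a + t • h‖ + (‖a‖ + t * (inner ℝ a h / ‖a‖))) = t ^ 2 * ‖a‖ * curvForm a h h := by
  have hA := norm_pos_iff.2 ha
  have hs : ‖a + t • h‖ ^ 2 = ‖a‖ ^ 2 + 2 * (t * inner ℝ a h) + t ^ 2 * ‖h‖ ^ 2 := by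
    rw [norm_add_sq_real, inner_smul_right, norm_smul, mul_pow, Real.norm_eq_abs, sq_abs]
  rw [curvForm, real_inner_self_eq_norm_sq]
  have : (‖a + t • h‖ - (‖a‖ + t * (inner ℝ a h / ‖a‖)))
      * (‖a + t • h‖ + (‖a‖ + t * (inner ℝ a h / ‖a‖)))
      = ‖a + t • h‖ ^ 2 - (‖a‖ + t * (inner ℝ a h / ‖a‖)) ^ 2 := by ring
  rw [this, hs]
  field_simp
  ring

theorem norm_remainder_abs {a : H} (ha : a ≠ 0) (h : H) (t : ℝ) :
    |‖a‖ + t * (inner ℝ a h / ‖a‖)| ≤ ‖a + t • h‖ := by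
  have hA := norm_pos_iff.2 ha
  have e : ‖a‖ + t * (inner ℝ a h / ‖a‖) = inner ℝ a (a + t • h) / ‖a‖ := by
    rw [inner_add_right, inner_smul_right, real_inner_self_eq_norm_sq]; field_simp
  rw [e, abs_div, abs_norm, div_le_iff₀ hA, mul_comm]
  exact abs_real_inner_le_norm _ _

theorem normDeriv_le (a h : H) {t : ℝ} (ht : 0 ≤ t) :
    t * normDeriv a h ≤ ‖a + t • h‖ - ‖a‖ := by
  by_cases ha : a = 0
  · subst ha; simp [normDeriv_zero_left, norm_smul, abs_of_nonneg ht]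
  · rw [normDeriv_of_ne ha]
    linarith [norm_remainder_abs ha h t, le_abs_self (‖a‖ + t * (inner ℝ a h / ‖a‖))]

/-- A lower bound for the second-order remainder of the norm that is affine in `h`, up to a
perturbation of order `t`. -/
theorem norm_remainder_lower (a h k : H) {t : ℝ} (ht : 0 ≤ t) :
    t ^ 2 / 2 * (2 * curvForm a h k - curvForm a k k - t * ‖h‖ * (curvForm a k k / ‖a‖))
      ≤ ‖a + t • h‖ - ‖a‖ - t * normDeriv a h := by
  by_cases ha : a = 0
  · subst ha; simp [normDeriv_zero_left, norm_smul, abs_of_nonneg ht, curvForm_zero_left]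
  have hA := norm_pos_iff.2 ha
  rw [normDeriv_of_ne ha]
  have hmul := norm_remainder_mul ha h t
  have habs := abs_le.1 (norm_remainder_abs ha h t)
  have htri : ‖a + t • h‖ ≤ ‖a‖ + t * ‖h‖ := by
    refine (norm_add_le _ _).trans_eq ?_
    rw [norm_smul, Real.norm_eq_abs, abs_of_nonneg ht]
  have hk := curvForm_self_nonneg a k
  set s := ‖a + t • h‖ with hs
  set q := ‖a‖ + t * (inner ℝ a h / ‖a‖) with hq
  set A := ‖a‖
  have goal_eq : s - A - t * (inner ℝ a h / A) = s - q := by rw [hq]; ring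
  rw [goal_eq]
  have hs0 : 0 ≤ s := norm_nonneg _
  have hst : s / A * curvForm a k k ≤ curvForm a k k + t * ‖h‖ * (curvForm a k k / A) := by
    have : s / A * curvForm a k k ≤ (A + t * ‖h‖) / A * curvForm a k k := by gcongr
    refine this.trans_eq ?_
    field_simp
  rcases hs0.eq_or_lt with h0 | hpos
  · have hq0 : q = 0 := by
      rw [← h0] at habs; linarith
    rw [← h0, hq0, sub_zero, zero_mul] at hmul
    have h1 : t ^ 2 * curvForm a h h = 0 := by
      have : A * (t ^ 2 * curvForm a h h) = 0 := by linarith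
      exact (mul_eq_zero.1 this).resolve_left hA.ne'
    have h2 := mul_le_mul_of_nonneg_left (curvForm_linearize a h k 1) (sq_nonneg t)
    have h3 : 0 ≤ t ^ 2 / 2 * (t * ‖h‖ * (curvForm a k k / A)) := by positivity
    rw [← h0, hq0]
    nlinarith
  · have hlin := curvForm_linearize a h k (s / A)
    have h1 : t ^ 2 * A * (2 * (s / A) * curvForm a h k - (s / A) ^ 2 * curvForm a k k)
        ≤ (s - q) * (2 * s) := by
      calc _ ≤ t ^ 2 * A * curvForm a h h := by gcongr
        _ = (s - q) * (s + q) := hmul.symm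
        _ ≤ (s - q) * (2 * s) := by
          apply mul_le_mul_of_nonneg_left <;> linarith
    have h2 : t ^ 2 * A * (2 * (s / A) * curvForm a h k - (s / A) ^ 2 * curvForm a k k)
        = (t ^ 2 / 2 * (2 * curvForm a h k - s / A * curvForm a k k)) * (2 * s) := by
      field_simp
    rw [h2] at h1
    have h3 := le_of_mul_le_mul_right h1 (by positivity)
    exact le_trans (mul_le_mul_of_nonneg_left (by linarith) (by positivity)) h3

theorem norm_remainder_upper {a h : H} {t : ℝ} (ht : 0 ≤ t) (hlt : t * ‖h‖ < ‖a‖) :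
    ‖a + t • h‖ - ‖a‖ - t * normDeriv a h
      ≤ t ^ 2 / 2 * (curvForm a h h * (‖a‖ / (‖a‖ - t * ‖h‖))) := by
  have hA : 0 < ‖a‖ := lt_of_le_of_lt (by positivity) hlt
  have ha : a ≠ 0 := norm_pos_iff.1 hA
  rw [normDeriv_of_ne ha]
  have hmul := norm_remainder_mul ha h t
  have habs := abs_le.1 (norm_remainder_abs ha h t)
  have hin : -(t * ‖h‖) ≤ t * (inner ℝ a h / ‖a‖) := by
    have := (abs_le.1 (abs_normDeriv_le a h)).1
    rw [normDeriv_of_ne ha] at this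
    nlinarith
  have hc := curvForm_self_nonneg a h
  set s := ‖a + t • h‖ with hs
  set q := ‖a‖ + t * (inner ℝ a h / ‖a‖) with hq
  set A := ‖a‖
  have goal_eq : s - A - t * (inner ℝ a h / A) = s - q := by rw [hq]; ring
  rw [goal_eq]
  have hD : 0 < A - t * ‖h‖ := by linarith
  have e : t ^ 2 / 2 * (curvForm a h h * (A / (A - t * ‖h‖)))
      = (t ^ 2 * A * curvForm a h h) / (2 * (A - t * ‖h‖)) := by
    field_simp
  rw [e, le_div_iff₀ (by positivity), ← hmul]
  apply mul_le_mul_of_nonneg_left <;> linarith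

theorem tendsto_norm_quotient (a h : H) :
    Tendsto (fun t : ℝ => (‖a + t • h‖ - ‖a‖) / t) (𝓝[>] 0) (𝓝 (normDeriv a h)) := by
  by_cases ha : a = 0
  · subst ha
    refine tendsto_const_nhds.congr' ?_
    filter_upwards [self_mem_nhdsWithin] with t ht
    have ht : 0 < t := ht
    simp [normDeriv_zero_left, norm_smul, abs_of_pos ht, ht.ne']
  have hA := norm_pos_iff.2 ha
  have h0 : Tendsto (fun t : ℝ => t * ‖h‖) (𝓝[>] 0) (𝓝 0) := by
    have : Tendsto (fun t : ℝ => t * ‖h‖) (𝓝 0) (𝓝 0) :=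
      Continuous.tendsto' (by fun_prop) _ _ (zero_mul _)
    exact this.mono_left nhdsWithin_le_nhds
  have hup : Tendsto (fun t : ℝ => normDeriv a h
      + t / 2 * (curvForm a h h * (‖a‖ / (‖a‖ - t * ‖h‖)))) (𝓝[>] 0) (𝓝 (normDeriv a h)) := by
    have : Tendsto (fun t : ℝ => normDeriv a h
      + t / 2 * (curvForm a h h * (‖a‖ / (‖a‖ - t * ‖h‖)))) (𝓝 0) (𝓝 (normDeriv a h
      + 0 / 2 * (curvForm a h h * (‖a‖ / (‖a‖ - 0 * ‖h‖))))) := by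
      apply ContinuousAt.tendsto
      have : ‖a‖ - 0 * ‖h‖ ≠ 0 := by simpa using hA.ne'
      fun_prop (disch := assumption)
    simp only [zero_div, zero_mul, add_zero] at this
    exact this.mono_left nhdsWithin_le_nhds
  refine tendsto_of_tendsto_of_tendsto_of_le_of_le' tendsto_const_nhds hup ?_ ?_
  · filter_upwards [self_mem_nhdsWithin] with t ht
    have ht : 0 < t := ht
    rw [le_div_iff₀ ht, mul_comm]
    exact normDeriv_le a h ht.le
  · filter_upwards [self_mem_nhdsWithin, h0.eventually_lt_const hA] with t ht hlt
    have ht : 0 < t := ht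
    rw [div_le_iff₀ ht]
    have := norm_remainder_upper ht.le hlt
    nlinarith

theorem abs_norm_quotient_le (a h : H) {t : ℝ} (ht : 0 < t) :
    |(‖a + t • h‖ - ‖a‖) / t| ≤ ‖h‖ := by
  rw [abs_div, abs_of_pos ht, div_le_iff₀ ht]
  refine (abs_norm_sub_norm_le _ _).trans_eq ?_
  rw [add_sub_cancel_left, norm_smul, Real.norm_eq_abs, abs_of_pos ht, mul_comm]

/-- The case of equality in the Cauchy-Schwarz inequality. -/
theorem eq_smul_of_inner_eq {w v : H} {μ : ℝ} (hμ : 0 < μ) (hw : ‖w‖ ≤ μ)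
    (he : μ * ‖v‖ = inner ℝ w v) : v = (‖v‖ / μ) • w := by
  have h : ‖v - (‖v‖ / μ) • w‖ ^ 2 ≤ 0 := by
    rw [norm_sub_sq_real, inner_smul_right, real_inner_comm, ← he, norm_smul, Real.norm_eq_abs,
      abs_of_nonneg (by positivity)]
    have e : ‖v‖ ^ 2 - 2 * (‖v‖ / μ * (μ * ‖v‖)) + (‖v‖ / μ * ‖w‖) ^ 2
        = (‖v‖ / μ) ^ 2 * (‖w‖ ^ 2 - μ ^ 2) := by
      field_simp; ring
    rw [e]
    have : ‖w‖ ^ 2 ≤ μ ^ 2 := by gcongr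
    exact mul_nonpos_of_nonneg_of_nonpos (by positivity) (by linarith)
  have : ‖v - (‖v‖ / μ) • w‖ = 0 := by
    have := sq_nonneg ‖v - (‖v‖ / μ) • w‖
    exact pow_eq_zero_iff two_ne_zero |>.1 (le_antisymm h this)
  exact sub_eq_zero.1 (norm_eq_zero.1 this)

end Pointwise

/-! ### Slices of square-integrable functions on a product space -/

section Slices

variable {X Y : Type*} [MeasurableSpace X] [MeasurableSpace Y] {ν : Measure X} {τ : Measure Y}

open Classical in
/-- The slice `f (x, ·)` as an element of `L²(τ)`; it is `0` for those `x`, forming a null set,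
for which `f (x, ·)` is not square-integrable. -/
noncomputable def slice (f : Lp ℝ 2 (ν.prod τ)) (x : X) : Lp ℝ 2 τ :=
  if hx : MemLp (fun y => f (x, y)) 2 τ then hx.toLp else 0

theorem integrable_mul_Lp (f g : Lp ℝ 2 (ν.prod τ)) :
    Integrable (fun p => f p * g p) (ν.prod τ) := by
  have := L2.integrable_inner (𝕜 := ℝ) g f
  simpa using this

variable {E : Set (X × Y)} (hE : MeasurableSet E)

/-- The mixed norm `L¹(ν; L²(τ))`. -/
noncomputable def normIntegral (f : Lp ℝ 2 (ν.prod τ)) : ℝ := ∫ x, ‖slice f x‖ ∂ν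

theorem normIntegral_nonneg (f : Lp ℝ 2 (ν.prod τ)) : 0 ≤ normIntegral f :=
  integral_nonneg fun _ => norm_nonneg _

/-- Multiplication with the indicator function of `E`. -/
noncomputable def cut (f : Lp ℝ 2 (ν.prod τ)) :
    Lp ℝ 2 (ν.prod τ) :=
  ((Lp.memLp f).indicator hE).toLp (E.indicator f)

theorem cut_coe (f : Lp ℝ 2 (ν.prod τ)) : cut hE f =ᵐ[ν.prod τ] E.indicator f :=
  MemLp.coeFn_toLp _

theorem cut_add (f g : Lp ℝ 2 (ν.prod τ)) : cut hE (f + g) = cut hE f + cut hE g := by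
  apply Lp.ext
  filter_upwards [cut_coe hE f, cut_coe hE g, cut_coe hE (f + g), Lp.coeFn_add f g,
    Lp.coeFn_add (cut hE f) (cut hE g)] with p h1 h2 h3 h4 h5
  rw [h3, h5, Pi.add_apply, h1, h2]
  by_cases hp : p ∈ E
  · rw [Set.indicator_of_mem hp, Set.indicator_of_mem hp, Set.indicator_of_mem hp, h4,
      Pi.add_apply]
  · simp [hp]

theorem cut_add_cut_compl (f : Lp ℝ 2 (ν.prod τ)) : cut hE f + cut hE.compl f = f := by
  apply Lp.ext
  filter_upwards [cut_coe hE f, cut_coe hE.compl f,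
    Lp.coeFn_add (cut hE f) (cut hE.compl f)] with p h1 h2 h5
  rw [h5, Pi.add_apply, h1, h2]
  by_cases hp : p ∈ E <;> simp [hp]

theorem norm_cut_le (f : Lp ℝ 2 (ν.prod τ)) : ‖cut hE f‖ ≤ ‖f‖ := by
  apply Lp.norm_le_norm_of_ae_le
  filter_upwards [cut_coe hE f] with p h1
  rw [h1]
  exact norm_indicator_le_norm_self _ _

theorem cut_neg (f : Lp ℝ 2 (ν.prod τ)) : cut hE (-f) = -cut hE f := by
  have := cut_add hE f (-f)
  have h0 : cut hE (0 : Lp ℝ 2 (ν.prod τ)) = 0 :=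
    norm_le_zero_iff.1 ((norm_cut_le hE _).trans_eq norm_zero)
  rw [add_neg_cancel, h0] at this
  exact (neg_eq_of_add_eq_zero_right this.symm).symm

theorem continuous_cut : Continuous (cut hE : Lp ℝ 2 (ν.prod τ) → Lp ℝ 2 (ν.prod τ)) := by
  refine (LipschitzWith.of_dist_le_mul (K := 1) fun f g => ?_).continuous
  rw [dist_eq_norm, dist_eq_norm, NNReal.coe_one, one_mul, sub_eq_add_neg, ← cut_neg, ← cut_add,
    ← sub_eq_add_neg]
  exact norm_cut_le hE _

theorem norm_slice (f : Lp ℝ 2 (ν.prod τ)) (x : X) :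
    ‖slice f x‖ = Real.sqrt (∫ y, f (x, y) ^ 2 ∂τ) := by
  have hm : AEStronglyMeasurable (fun y => f (x, y)) τ :=
    ((Lp.stronglyMeasurable f).comp_measurable measurable_prodMk_left).aestronglyMeasurable
  by_cases hx : MemLp (fun y => f (x, y)) 2 τ
  · rw [← Real.sqrt_sq (norm_nonneg (slice f x)), ← real_inner_self_eq_norm_sq, L2.inner_def,
      slice, dif_pos hx]
    congr 1
    apply integral_congr_ae
    filter_upwards [hx.coeFn_toLp] with y e1
    rw [e1]; simp [sq]
  · -- the Bochner integral of the non-integrable function `f (x, ·) ^ 2` is `0`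
    rw [slice, dif_neg hx, norm_zero, integral_undef, Real.sqrt_zero]
    rwa [← memLp_two_iff_integrable_sq hm]

/-- Cutting with sets that eventually contain almost every point is an approximation of the
identity. -/
theorem tendsto_cut {E : ℕ → Set (X × Y)} (hE : ∀ n, MeasurableSet (E n))
    (f : Lp ℝ 2 (ν.prod τ)) (hf : ∀ᵐ p ∂ν.prod τ, ∀ᶠ n in atTop, p ∈ E n) :
    Tendsto (fun n => cut (hE n) f) atTop (𝓝 f) := by
  rw [tendsto_iff_norm_sub_tendsto_zero]
  have key : Tendsto (fun n => ∫ p, (cut (hE n) f - f : Lp ℝ 2 (ν.prod τ)) p ^ 2 ∂ν.prod τ) atTop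
      (𝓝 (∫ _, (0 : ℝ) ∂ν.prod τ)) := by
    have hall : ∀ᵐ p ∂ν.prod τ, ∀ n, (cut (hE n) f - f : Lp ℝ 2 (ν.prod τ)) p
        = (E n).indicator f p - f p := by
      rw [ae_all_iff]
      intro n
      filter_upwards [cut_coe (hE n) f, Lp.coeFn_sub (cut (hE n) f) f] with p h1 h2
      rw [h2, Pi.sub_apply, h1]
    refine tendsto_integral_of_dominated_convergence (fun p => f p ^ 2)
      (fun n => ((Lp.aestronglyMeasurable _).pow 2)) ?_ ?_ ?_
    · simpa [sq] using integrable_mul_Lp f f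
    · intro n
      filter_upwards [hall] with p hp
      rw [hp n]
      by_cases h : p ∈ E n <;> simp [h, sq_nonneg]
    · filter_upwards [hall, hf] with p hp hev
      refine tendsto_const_nhds.congr' ?_
      filter_upwards [hev] with n hn
      rw [hp n]
      simp [hn]
  simp only [integral_zero] at key
  have e : ∀ g : Lp ℝ 2 (ν.prod τ), ∫ p, g p ^ 2 ∂ν.prod τ = ‖g‖ ^ 2 := by
    intro g
    rw [← real_inner_self_eq_norm_sq, L2.inner_def]
    simp [sq]
  simp_rw [e] at key
  have := key.sqrt
  simpa [Real.sqrt_sq (norm_nonneg _)] using this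

section Finite

variable [IsFiniteMeasure ν] [IsFiniteMeasure τ]

theorem ae_memLp_slice (f : Lp ℝ 2 (ν.prod τ)) :
    ∀ᵐ x ∂ν, MemLp (fun y => f (x, y)) 2 τ := by
  filter_upwards [(integrable_mul_Lp f f).prod_right_ae] with x hx
  rw [memLp_two_iff_integrable_sq]
  · simpa [sq] using hx
  · exact ((Lp.stronglyMeasurable f).comp_measurable measurable_prodMk_left).aestronglyMeasurable

theorem slice_coe (f : Lp ℝ 2 (ν.prod τ)) :
    ∀ᵐ x ∂ν, (slice f x : Y → ℝ) =ᵐ[τ] fun y => f (x, y) := by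
  filter_upwards [ae_memLp_slice f] with x hx
  rw [slice, dif_pos hx]
  exact hx.coeFn_toLp

theorem slice_add (f g : Lp ℝ 2 (ν.prod τ)) :
    ∀ᵐ x ∂ν, slice (f + g) x = slice f x + slice g x := by
  filter_upwards [slice_coe f, slice_coe g, slice_coe (f + g),
    Measure.ae_ae_of_ae_prod (Lp.coeFn_add f g)] with x h1 h2 h3 h4
  apply Lp.ext
  filter_upwards [h1, h2, h3, h4, Lp.coeFn_add (slice f x) (slice g x)] with y e1 e2 e3 e4 e5
  rw [e5, Pi.add_apply, e1, e2, e3, e4, Pi.add_apply]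

theorem slice_smul (c : ℝ) (f : Lp ℝ 2 (ν.prod τ)) :
    ∀ᵐ x ∂ν, slice (c • f) x = c • slice f x := by
  filter_upwards [slice_coe f, slice_coe (c • f),
    Measure.ae_ae_of_ae_prod (Lp.coeFn_smul c f)] with x h1 h3 h4
  apply Lp.ext
  filter_upwards [h1, h3, h4, Lp.coeFn_smul c (slice f x)] with y e1 e3 e4 e5
  rw [e5, Pi.smul_apply, e1, e3, e4, Pi.smul_apply]

theorem slice_add_smul (f g : Lp ℝ 2 (ν.prod τ)) (c : ℝ) :
    ∀ᵐ x ∂ν, slice (f + c • g) x = slice f x + c • slice g x := by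
  filter_upwards [slice_add f (c • g), slice_smul c g] with x h1 h2
  rw [h1, h2]

theorem slice_sub (f g : Lp ℝ 2 (ν.prod τ)) :
    ∀ᵐ x ∂ν, slice (f - g) x = slice f x - slice g x := by
  filter_upwards [slice_add_smul f g (-1)] with x h1
  simpa [sub_eq_add_neg] using h1

theorem inner_slice (f g : Lp ℝ 2 (ν.prod τ)) :
    ∀ᵐ x ∂ν, (inner ℝ (slice f x) (slice g x) : ℝ) = ∫ y, f (x, y) * g (x, y) ∂τ := by
  filter_upwards [slice_coe f, slice_coe g] with x h1 h2
  rw [L2.inner_def]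
  apply integral_congr_ae
  filter_upwards [h1, h2] with y e1 e2
  rw [e1, e2]; simp [mul_comm]

theorem integrable_inner_slice (f g : Lp ℝ 2 (ν.prod τ)) :
    Integrable (fun x => (inner ℝ (slice f x) (slice g x) : ℝ)) ν :=
  (integrable_mul_Lp f g).integral_prod_left.congr ((inner_slice f g).mono fun _ h => h.symm)

theorem integral_inner_slice (f g : Lp ℝ 2 (ν.prod τ)) :
    ∫ x, (inner ℝ (slice f x) (slice g x) : ℝ) ∂ν = inner ℝ f g := by
  rw [integral_congr_ae (inner_slice f g), ← integral_prod _ (integrable_mul_Lp f g), L2.inner_def]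
  simp [mul_comm]

omit [IsFiniteMeasure ν] in
theorem measurable_norm_slice (f : Lp ℝ 2 (ν.prod τ)) : Measurable fun x => ‖slice f x‖ := by
  simp_rw [norm_slice]
  exact (((Lp.stronglyMeasurable f).pow 2).integral_prod_right').measurable.sqrt

theorem aemeasurable_inner_slice (f g : Lp ℝ 2 (ν.prod τ)) :
    AEMeasurable (fun x => (inner ℝ (slice f x) (slice g x) : ℝ)) ν :=
  (integrable_inner_slice f g).aemeasurable

theorem integrable_norm_sq_slice (f : Lp ℝ 2 (ν.prod τ)) :
    Integrable (fun x => ‖slice f x‖ ^ 2) ν := by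
  simpa [real_inner_self_eq_norm_sq] using integrable_inner_slice f f

theorem integral_norm_sq_slice (f : Lp ℝ 2 (ν.prod τ)) :
    ∫ x, ‖slice f x‖ ^ 2 ∂ν = ‖f‖ ^ 2 := by
  simpa [real_inner_self_eq_norm_sq] using integral_inner_slice f f

theorem integrable_norm_slice (f : Lp ℝ 2 (ν.prod τ)) :
    Integrable (fun x => ‖slice f x‖) ν := by
  refine ((integrable_const (1 : ℝ)).add (integrable_norm_sq_slice f)).mono'
    (measurable_norm_slice f).aestronglyMeasurable (ae_of_all _ fun x => ?_)
  simp only [Real.norm_eq_abs, abs_norm, Pi.add_apply]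
  nlinarith [sq_nonneg (‖slice f x‖ - 1), norm_nonneg (slice f x)]

theorem normIntegral_le (f : Lp ℝ 2 (ν.prod τ)) :
    normIntegral f ≤ (ν.real Set.univ + 1) / 2 * ‖f‖ := by
  rcases (norm_nonneg f).eq_or_lt with h0 | hpos
  · rw [← h0, mul_zero]
    have h1 : ∫ x, ‖slice f x‖ ^ 2 ∂ν = 0 := by rw [integral_norm_sq_slice, ← h0]; simp
    rw [integral_eq_zero_iff_of_nonneg (fun x => by positivity) (integrable_norm_sq_slice f)] at h1
    refine (integral_eq_zero_of_ae ?_).le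
    filter_upwards [h1] with x hx
    simpa using hx
  -- weighted arithmetic-geometric mean inequality on each slice
  have : ∀ x, ‖slice f x‖ ≤ ‖f‖ / 2 + (1 / (2 * ‖f‖)) * ‖slice f x‖ ^ 2 := by
    intro x
    have e : ‖f‖ / 2 + (1 / (2 * ‖f‖)) * ‖slice f x‖ ^ 2 - ‖slice f x‖
        = (‖f‖ - ‖slice f x‖) ^ 2 / (2 * ‖f‖) := by field_simp; ring
    have : 0 ≤ (‖f‖ - ‖slice f x‖) ^ 2 / (2 * ‖f‖) := by positivity
    linarith
  calc normIntegral f ≤ ∫ x, (‖f‖ / 2 + (1 / (2 * ‖f‖)) * ‖slice f x‖ ^ 2) ∂ν :=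
        integral_mono (integrable_norm_slice f)
          ((integrable_const _).add ((integrable_norm_sq_slice f).const_mul _)) this
    _ = (ν.real Set.univ + 1) / 2 * ‖f‖ := by
        rw [integral_add (integrable_const _) ((integrable_norm_sq_slice f).const_mul _),
          integral_const_mul, integral_norm_sq_slice, integral_const, smul_eq_mul]
        field_simp

theorem norm_slice_cut_le (f : Lp ℝ 2 (ν.prod τ)) :
    ∀ᵐ x ∂ν, ‖slice (cut hE f) x‖ ≤ ‖slice f x‖ := by
  filter_upwards [slice_coe f, slice_coe (cut hE f),
    Measure.ae_ae_of_ae_prod (cut_coe hE f)] with x h1 h2 h3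
  apply Lp.norm_le_norm_of_ae_le
  filter_upwards [h1, h2, h3] with y e1 e2 e3
  rw [e1, e2, e3]
  exact norm_indicator_le_norm_self _ _

theorem slice_cut_of_mem (f : Lp ℝ 2 (ν.prod τ)) :
    ∀ᵐ x ∂ν, (∀ y, (x, y) ∈ E) → slice (cut hE f) x = slice f x := by
  filter_upwards [slice_coe f, slice_coe (cut hE f),
    Measure.ae_ae_of_ae_prod (cut_coe hE f)] with x h1 h2 h3 hx
  apply Lp.ext
  filter_upwards [h1, h2, h3] with y e1 e2 e3
  rw [e1, e2, e3, Set.indicator_of_mem (hx y)]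

theorem slice_cut_of_notMem (f : Lp ℝ 2 (ν.prod τ)) :
    ∀ᵐ x ∂ν, (∀ y, (x, y) ∉ E) → slice (cut hE f) x = 0 := by
  filter_upwards [slice_coe (cut hE f),
    Measure.ae_ae_of_ae_prod (cut_coe hE f)] with x h2 h3 hx
  apply Lp.ext
  filter_upwards [h2, h3, Lp.coeFn_zero ℝ 2 τ] with y e2 e3 e4
  rw [e2, e3, Set.indicator_of_notMem (hx y), e4, Pi.zero_apply]

end Finite

end Slices

/-! ### First- and second-order expansion of the mixed norm -/

section Expansion

variable {X Y : Type*} [MeasurableSpace X] [MeasurableSpace Y] {ν : Measure X} {τ : Measure Y}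

/-- The directional derivative of `normIntegral` at `u` in the direction `h`. -/
noncomputable def dirDeriv (u h : Lp ℝ 2 (ν.prod τ)) : ℝ :=
  ∫ x, normDeriv (slice u x) (slice h x) ∂ν

/-- The second derivative of `normIntegral` at `u` as a quadratic form in `h`. It is meaningful
if the integrand is integrable. -/
noncomputable def quadForm (u h : Lp ℝ 2 (ν.prod τ)) : ℝ :=
  ∫ x, curvForm (slice u x) (slice h x) (slice h x) ∂ν

theorem quadForm_nonneg (u h : Lp ℝ 2 (ν.prod τ)) : 0 ≤ quadForm u h :=
  integral_nonneg fun _ => curvForm_self_nonneg _ _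

/-- Where the slices of `u` and `h` both do not vanish, those of `u` have norm at least `1 / n`. -/
def AwayFromZero (n : ℝ) (u h : Lp ℝ 2 (ν.prod τ)) : Prop :=
  ∀ᵐ x ∂ν, slice u x ≠ 0 → slice h x ≠ 0 → 1 / n ≤ ‖slice u x‖

variable [IsFiniteMeasure ν] [IsFiniteMeasure τ]

theorem aestronglyMeasurable_normDeriv (u h : Lp ℝ 2 (ν.prod τ)) :
    AEStronglyMeasurable (fun x => normDeriv (slice u x) (slice h x)) ν := by
  have hs : MeasurableSet {x | ‖slice u x‖ = 0} :=
    measurable_norm_slice u (measurableSet_singleton 0)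
  have h1 : AEMeasurable (fun x => (inner ℝ (slice u x) (slice h x) : ℝ) / ‖slice u x‖
      + {x | ‖slice u x‖ = 0}.indicator (fun x => ‖slice h x‖) x) ν :=
    ((aemeasurable_inner_slice u h).div (measurable_norm_slice u).aemeasurable).add
      ((measurable_norm_slice h).indicator hs).aemeasurable
  refine h1.aestronglyMeasurable.congr (ae_of_all _ fun x => ?_)
  by_cases hx : slice u x = 0 <;> simp [normDeriv, hx]

theorem integrable_normDeriv (u h : Lp ℝ 2 (ν.prod τ)) :
    Integrable (fun x => normDeriv (slice u x) (slice h x)) ν :=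
  (integrable_norm_slice h).mono' (aestronglyMeasurable_normDeriv u h)
    (ae_of_all _ fun _ => abs_normDeriv_le _ _)

theorem aemeasurable_curvForm (u h k : Lp ℝ 2 (ν.prod τ)) :
    AEMeasurable (fun x => curvForm (slice u x) (slice h x) (slice k x)) ν :=
  ((aemeasurable_inner_slice h k).sub (((aemeasurable_inner_slice u h).mul
    (aemeasurable_inner_slice u k)).div ((measurable_norm_slice u).aemeasurable.pow_const 2))).div
    (measurable_norm_slice u).aemeasurable

theorem dirDeriv_le_normIntegral (u h : Lp ℝ 2 (ν.prod τ)) : dirDeriv u h ≤ normIntegral h :=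
  integral_mono (integrable_normDeriv u h) (integrable_norm_slice h)
    fun _ => (le_abs_self _).trans (abs_normDeriv_le _ _)

theorem dirDeriv_add_le (u h k : Lp ℝ 2 (ν.prod τ)) :
    dirDeriv u (h + k) ≤ dirDeriv u h + dirDeriv u k := by
  rw [dirDeriv, dirDeriv, dirDeriv, ← integral_add (integrable_normDeriv u h)
    (integrable_normDeriv u k)]
  refine integral_mono_ae (integrable_normDeriv u _)
    ((integrable_normDeriv u h).add (integrable_normDeriv u k)) ?_
  filter_upwards [slice_add h k] with x hx
  rw [hx]
  exact normDeriv_add_le _ _ _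

/-- The directional derivative is additive for directions that do not interact on the set where
`u` vanishes. -/
theorem dirDeriv_add_of_zero {u h k : Lp ℝ 2 (ν.prod τ)}
    (hz : ∀ᵐ x ∂ν, slice u x = 0 → slice h x = 0 ∨ slice k x = 0) :
    dirDeriv u (h + k) = dirDeriv u h + dirDeriv u k := by
  rw [dirDeriv, dirDeriv, dirDeriv, ← integral_add (integrable_normDeriv u h)
    (integrable_normDeriv u k)]
  apply integral_congr_ae
  filter_upwards [slice_add h k, hz] with x hx hzx
  rw [hx]
  exact normDeriv_add_of_zero hzx

theorem dirDeriv_smul {c : ℝ} (hc : 0 ≤ c) (u h : Lp ℝ 2 (ν.prod τ)) :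
    dirDeriv u (c • h) = c * dirDeriv u h := by
  rw [dirDeriv, dirDeriv, ← integral_const_mul]
  apply integral_congr_ae
  filter_upwards [slice_smul c h] with x hx
  rw [hx, normDeriv_smul hc]

theorem convexOn_dirDeriv (u : Lp ℝ 2 (ν.prod τ)) : ConvexOn ℝ Set.univ (dirDeriv u) := by
  refine ⟨convex_univ, fun h _ k _ a b ha hb _ => ?_⟩
  refine (dirDeriv_add_le u _ _).trans_eq ?_
  rw [dirDeriv_smul ha, dirDeriv_smul hb, smul_eq_mul, smul_eq_mul]

theorem continuous_dirDeriv (u : Lp ℝ 2 (ν.prod τ)) : Continuous (dirDeriv u) := by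
  have key : ∀ h k : Lp ℝ 2 (ν.prod τ),
      dirDeriv u h - dirDeriv u k ≤ (ν.real Set.univ + 1) / 2 * ‖h - k‖ := by
    intro h k
    have h1 := dirDeriv_add_le u k (h - k)
    rw [add_sub_cancel] at h1
    linarith [dirDeriv_le_normIntegral u (h - k), normIntegral_le (h - k)]
  refine (LipschitzWith.of_dist_le_mul (K := ((ν.real Set.univ + 1) / 2).toNNReal)
    fun h k => ?_).continuous
  rw [Real.dist_eq, dist_eq_norm, Real.coe_toNNReal _ (by positivity)]
  refine abs_le.2 ⟨?_, key h k⟩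
  have := key k h
  rw [norm_sub_rev] at this
  linarith

theorem normIntegral_add_smul_sub (u h : Lp ℝ 2 (ν.prod τ)) (t : ℝ) :
    normIntegral (u + t • h) - normIntegral u
      = ∫ x, (‖slice u x + t • slice h x‖ - ‖slice u x‖) ∂ν := by
  rw [normIntegral, normIntegral, ← integral_sub (integrable_norm_slice _) (integrable_norm_slice _)]
  apply integral_congr_ae
  filter_upwards [slice_add_smul u h t] with x hx
  rw [hx]

theorem integrable_norm_slice_add_smul (u h : Lp ℝ 2 (ν.prod τ)) (t : ℝ) :
    Integrable (fun x => ‖slice u x + t • slice h x‖) ν := by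
  refine (integrable_norm_slice (u + t • h)).congr ?_
  filter_upwards [slice_add_smul u h t] with x hx
  rw [hx]

theorem integrable_remainder (u h : Lp ℝ 2 (ν.prod τ)) (t : ℝ) :
    Integrable (fun x => ‖slice u x + t • slice h x‖ - ‖slice u x‖
      - t * normDeriv (slice u x) (slice h x)) ν :=
  ((integrable_norm_slice_add_smul u h t).sub (integrable_norm_slice u)).sub
    ((integrable_normDeriv u h).const_mul t)

theorem remainder_eq (u h : Lp ℝ 2 (ν.prod τ)) (t : ℝ) :
    normIntegral (u + t • h) - normIntegral u - t * dirDeriv u h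
      = ∫ x, (‖slice u x + t • slice h x‖ - ‖slice u x‖
          - t * normDeriv (slice u x) (slice h x)) ∂ν := by
  have hi : Integrable (fun x => ‖slice u x + t • slice h x‖ - ‖slice u x‖) ν :=
    (integrable_norm_slice_add_smul u h t).sub (integrable_norm_slice u)
  rw [integral_sub hi ((integrable_normDeriv u h).const_mul t), integral_const_mul,
    normIntegral_add_smul_sub, dirDeriv]

theorem mul_dirDeriv_le (u h : Lp ℝ 2 (ν.prod τ)) {t : ℝ} (ht : 0 ≤ t) :
    t * dirDeriv u h ≤ normIntegral (u + t • h) - normIntegral u := by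
  rw [← sub_nonneg, remainder_eq]
  exact integral_nonneg fun x => sub_nonneg.2 (normDeriv_le _ _ ht)

theorem tendsto_normIntegral_quotient (u h : Lp ℝ 2 (ν.prod τ)) :
    Tendsto (fun t : ℝ => (normIntegral (u + t • h) - normIntegral u) / t) (𝓝[>] 0)
      (𝓝 (dirDeriv u h)) := by
  simp_rw [normIntegral_add_smul_sub, ← integral_div]
  refine tendsto_integral_filter_of_dominated_convergence (fun x => ‖slice h x‖) ?_ ?_
    (integrable_norm_slice h) (ae_of_all _ fun x => tendsto_norm_quotient _ _)
  · exact Eventually.of_forall fun t => (((integrable_norm_slice_add_smul u h t).sub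
      (integrable_norm_slice u)).div_const t).aestronglyMeasurable
  · filter_upwards [self_mem_nhdsWithin] with t ht
    exact ae_of_all _ fun x => abs_norm_quotient_le _ _ ht

/-! ### A lower bound for the remainder, affine in the direction -/

/-- The points `x` at which the slice of `u` is not small and the slice of `v` is not large. -/
def truncSet (n : ℝ) (u v : Lp ℝ 2 (ν.prod τ)) : Set X :=
  {x | 1 / n ≤ ‖slice u x‖ ∧ ‖slice v x‖ ≤ n}

omit [IsFiniteMeasure ν] in
theorem measurableSet_truncSet (n : ℝ) (u v : Lp ℝ 2 (ν.prod τ)) :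
    MeasurableSet (truncSet n u v) :=
  (measurableSet_le measurable_const (measurable_norm_slice u)).inter
    (measurableSet_le (measurable_norm_slice v) measurable_const)

omit [IsFiniteMeasure ν] [IsFiniteMeasure τ] in
theorem abs_curvForm_le_of_mem {n : ℝ} (hn : 0 < n) {u v : Lp ℝ 2 (ν.prod τ)} {x : X}
    (hx : x ∈ truncSet n u v) (h : Lp ℝ 2 τ) :
    |curvForm (slice u x) h (slice v x)| ≤ 2 * n ^ 2 * ‖h‖ := by
  have h1 : 0 < 1 / n := by positivity
  have h2 : 0 < ‖slice u x‖ := h1.trans_le hx.1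
  refine (abs_curvForm_le _ _ _).trans ?_
  rw [div_le_iff₀ h2]
  have h3 : 1 ≤ n * ‖slice u x‖ := by
    have := mul_le_mul_of_nonneg_left hx.1 hn.le
    rwa [mul_one_div_cancel hn.ne'] at this
  calc 2 * (‖h‖ * ‖slice v x‖) ≤ 2 * (‖h‖ * n) * 1 := by
        rw [mul_one]; gcongr; exact hx.2
    _ ≤ 2 * (‖h‖ * n) * (n * ‖slice u x‖) := by gcongr
    _ = _ := by ring

theorem integrableOn_curvForm {n : ℝ} (hn : 0 < n) (u v h : Lp ℝ 2 (ν.prod τ)) :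
    IntegrableOn (fun x => curvForm (slice u x) (slice h x) (slice v x)) (truncSet n u v) ν := by
  refine Integrable.mono' (((integrable_norm_slice h).const_mul (2 * n ^ 2)).integrableOn)
    (aemeasurable_curvForm u h v).aestronglyMeasurable.restrict ?_
  exact (ae_restrict_iff' (measurableSet_truncSet n u v)).2
    (ae_of_all _ fun x hx => abs_curvForm_le_of_mem hn hx _)

/-- The linear functional `h ↦ ∫ curvForm u(x) h(x) v(x) dx`, with the integral restricted to
`truncSet n u v` in order to make it bounded. -/
noncomputable def curvFunctional {n : ℝ} (hn : 0 < n) (u v : Lp ℝ 2 (ν.prod τ)) :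
    Lp ℝ 2 (ν.prod τ) →L[ℝ] ℝ :=
  LinearMap.mkContinuous
    { toFun := fun h => ∫ x in truncSet n u v, curvForm (slice u x) (slice h x) (slice v x) ∂ν
      map_add' := fun h k => by
        rw [← integral_add (integrableOn_curvForm hn u v h) (integrableOn_curvForm hn u v k)]
        apply integral_congr_ae
        filter_upwards [ae_restrict_of_ae (slice_add h k)] with x hx
        rw [hx, curvForm_add_left]
      map_smul' := fun c h => by
        rw [smul_eq_mul, RingHom.id_apply, ← integral_const_mul]
        apply integral_congr_ae
        filter_upwards [ae_restrict_of_ae (slice_smul c h)] with x hx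
        rw [hx, curvForm_smul_left] }
    (2 * n ^ 2 * ((ν.real Set.univ + 1) / 2)) (fun h => by
      change |∫ x in truncSet n u v, curvForm (slice u x) (slice h x) (slice v x) ∂ν| ≤ _
      calc _ ≤ ∫ x in truncSet n u v, |curvForm (slice u x) (slice h x) (slice v x)| ∂ν :=
            abs_integral_le_integral_abs
        _ ≤ ∫ x in truncSet n u v, 2 * n ^ 2 * ‖slice h x‖ ∂ν :=
            setIntegral_mono_on (integrableOn_curvForm hn u v h).abs
              ((integrable_norm_slice h).const_mul _).integrableOn
              (measurableSet_truncSet n u v) fun x hx => abs_curvForm_le_of_mem hn hx _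
        _ ≤ ∫ x, 2 * n ^ 2 * ‖slice h x‖ ∂ν :=
            setIntegral_le_integral ((integrable_norm_slice h).const_mul _)
              (ae_of_all _ fun x => by positivity)
        _ = 2 * n ^ 2 * normIntegral h := integral_const_mul _ _
        _ ≤ 2 * n ^ 2 * ((ν.real Set.univ + 1) / 2 * ‖h‖) := by
            gcongr; exact normIntegral_le h
        _ = _ := by ring)

theorem curvFunctional_apply {n : ℝ} (hn : 0 < n) (u v h : Lp ℝ 2 (ν.prod τ)) :
    curvFunctional hn u v h
      = ∫ x in truncSet n u v, curvForm (slice u x) (slice h x) (slice v x) ∂ν := rfl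

theorem remainder_lower {n : ℝ} (hn : 0 < n) (u v h : Lp ℝ 2 (ν.prod τ)) {t : ℝ} (ht : 0 ≤ t) :
    t ^ 2 / 2 * (2 * curvFunctional hn u v h - curvFunctional hn u v v
        - t * n ^ 4 * normIntegral h)
      ≤ normIntegral (u + t • h) - normIntegral u - t * dirDeriv u h := by
  have hA := measurableSet_truncSet n u v
  have ih := integrableOn_curvForm hn u v h
  have iv := integrableOn_curvForm hn u v v
  have iN : IntegrableOn (fun x => t * n ^ 4 * ‖slice h x‖) (truncSet n u v) ν :=
    ((integrable_norm_slice h).const_mul _).integrableOn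
  have id : IntegrableOn (fun x => 2 * curvForm (slice u x) (slice h x) (slice v x)
      - curvForm (slice u x) (slice v x) (slice v x)) (truncSet n u v) ν :=
    (ih.const_mul 2).sub iv
  have e1 : ∫ x in truncSet n u v, t ^ 2 / 2 * (2 * curvForm (slice u x) (slice h x) (slice v x)
      - curvForm (slice u x) (slice v x) (slice v x) - t * n ^ 4 * ‖slice h x‖) ∂ν
      = t ^ 2 / 2 * (2 * curvFunctional hn u v h - curvFunctional hn u v v
        - t * n ^ 4 * ∫ x in truncSet n u v, ‖slice h x‖ ∂ν) := by
    rw [integral_const_mul, integral_sub id iN,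
      integral_sub (ih.const_mul 2) iv, integral_const_mul, integral_const_mul]
    rfl
  have hNle : ∫ x in truncSet n u v, ‖slice h x‖ ∂ν ≤ normIntegral h :=
    setIntegral_le_integral (integrable_norm_slice h) (ae_of_all _ fun _ => norm_nonneg _)
  rw [remainder_eq]
  calc _ ≤ t ^ 2 / 2 * (2 * curvFunctional hn u v h - curvFunctional hn u v v
        - t * n ^ 4 * ∫ x in truncSet n u v, ‖slice h x‖ ∂ν) := by gcongr
    _ = _ := e1.symm
    _ ≤ ∫ x in truncSet n u v, (‖slice u x + t • slice h x‖ - ‖slice u x‖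
          - t * normDeriv (slice u x) (slice h x)) ∂ν := by
        refine setIntegral_mono_on ((id.sub iN).const_mul _)
          (integrable_remainder u h t).integrableOn hA fun x hx => ?_
        refine le_trans ?_ (norm_remainder_lower (slice u x) (slice h x) (slice v x) ht)
        have h1 : 0 < 1 / n := by positivity
        have h2 : 0 < ‖slice u x‖ := h1.trans_le hx.1
        have h3 : 1 ≤ n * ‖slice u x‖ := by
          have := mul_le_mul_of_nonneg_left hx.1 hn.le
          rwa [mul_one_div_cancel hn.ne'] at this
        have h4 : curvForm (slice u x) (slice v x) (slice v x) / ‖slice u x‖ ≤ n ^ 4 := by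
          rw [div_le_iff₀ h2]
          refine (curvForm_self_le _ _).trans ?_
          rw [div_le_iff₀ h2]
          calc ‖slice v x‖ ^ 2 ≤ n ^ 2 * 1 ^ 2 := by rw [one_pow, mul_one]; gcongr; exact hx.2
            _ ≤ n ^ 2 * (n * ‖slice u x‖) ^ 2 := by gcongr
            _ = _ := by ring
        have h5 : t * ‖slice h x‖ * (curvForm (slice u x) (slice v x) (slice v x) / ‖slice u x‖)
            ≤ t * ‖slice h x‖ * n ^ 4 := by gcongr
        exact mul_le_mul_of_nonneg_left (by linarith) (by positivity)
    _ ≤ _ := setIntegral_le_integral (integrable_remainder u h t)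
        (ae_of_all _ fun x => sub_nonneg.2 (normDeriv_le _ _ ht))

/-- The sets `truncSet n u v` exhaust the set on which `u` does not vanish. -/
theorem exists_lt_curvFunctional {u v : Lp ℝ 2 (ν.prod τ)} {c : ℝ≥0∞}
    (hc : c < ∫⁻ x, ENNReal.ofReal (curvForm (slice u x) (slice v x) (slice v x)) ∂ν) :
    ∃ (n : ℝ) (hn : 0 < n), c < ENNReal.ofReal (curvFunctional hn u v v) := by
  set f : X → ℝ≥0∞ := fun x => ENNReal.ofReal (curvForm (slice u x) (slice v x) (slice v x))
  have hmono : Monotone fun n : ℕ => truncSet ((n : ℝ) + 1) u v := by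
    intro m n hmn x hx
    have : (m : ℝ) ≤ n := by exact_mod_cast hmn
    refine ⟨le_trans ?_ hx.1, hx.2.trans (by linarith)⟩
    gcongr
  have hsupp : ∀ x, x ∉ ⋃ n : ℕ, truncSet ((n : ℝ) + 1) u v → f x = 0 := by
    intro x hx
    by_cases hu : slice u x = 0
    · simp [f, hu, curvForm_zero_left]
    have hpos := norm_pos_iff.2 hu
    obtain ⟨n, hn⟩ := exists_nat_ge (max (1 / ‖slice u x‖) ‖slice v x‖)
    refine absurd (Set.mem_iUnion.2 ⟨n, show _ ∧ _ from ⟨?_, ?_⟩⟩) hx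
    · have h1 := (le_max_left _ _).trans hn
      rw [div_le_iff₀ hpos] at h1
      rw [div_le_iff₀ (by positivity)]
      nlinarith
    · exact ((le_max_right _ _).trans hn).trans (by linarith)
  have h1 : ∫⁻ x, f x ∂ν = ⨆ n : ℕ, ∫⁻ x in truncSet ((n : ℝ) + 1) u v, f x ∂ν := by
    rw [← setLIntegral_iUnion_of_directed _ (hmono.directed_le)]
    rw [← lintegral_indicator (MeasurableSet.iUnion fun n => measurableSet_truncSet _ u v),
      Set.indicator_eq_self.2 (Function.support_subset_iff'.2 hsupp)]
  rw [h1, lt_iSup_iff] at hc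
  obtain ⟨n, hn⟩ := hc
  refine ⟨(n : ℝ) + 1, by positivity, ?_⟩
  rwa [curvFunctional_apply, ofReal_integral_eq_lintegral_ofReal
    (integrableOn_curvForm (by positivity) u v v) (ae_of_all _ fun _ => curvForm_self_nonneg _ _)]

/-! ### An upper bound for the remainder -/

omit [IsFiniteMeasure ν] [IsFiniteMeasure τ] in
theorem AwayFromZero.curvForm_le {n : ℝ} (hn : 0 < n) {u h : Lp ℝ 2 (ν.prod τ)}
    (ha : AwayFromZero n u h) :
    ∀ᵐ x ∂ν, curvForm (slice u x) (slice h x) (slice h x) ≤ n * ‖slice h x‖ ^ 2 := by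
  filter_upwards [ha] with x hx
  by_cases h0 : slice u x = 0
  · rw [h0, curvForm_zero_left]; positivity
  by_cases h1 : slice h x = 0
  · rw [h1, curvForm_zero_zero]; positivity
  refine (curvForm_self_le _ _).trans ?_
  rw [div_le_iff₀ (norm_pos_iff.2 h0)]
  have := mul_le_mul_of_nonneg_left (hx h0 h1) hn.le
  rw [mul_one_div_cancel hn.ne'] at this
  nlinarith [sq_nonneg ‖slice h x‖]

theorem AwayFromZero.integrable {n : ℝ} (hn : 0 < n) {u h : Lp ℝ 2 (ν.prod τ)}
    (ha : AwayFromZero n u h) :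
    Integrable (fun x => curvForm (slice u x) (slice h x) (slice h x)) ν := by
  refine ((integrable_norm_sq_slice h).const_mul n).mono'
    (aemeasurable_curvForm u h h).aestronglyMeasurable ?_
  filter_upwards [ha.curvForm_le hn] with x hx
  rwa [Real.norm_eq_abs, abs_of_nonneg (curvForm_self_nonneg _ _)]

/-- Young's inequality for `quadForm`, with the perturbation controlled by its norm. -/
theorem quadForm_add_le {n : ℝ} (hn : 0 < n) {u h k : Lp ℝ 2 (ν.prod τ)}
    (hh : AwayFromZero n u h) (hk : AwayFromZero n u k) {δ : ℝ} (hδ : 0 < δ) :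
    quadForm u (h + k) ≤ (1 + δ) * quadForm u h + (1 + 1 / δ) * (n * ‖k‖ ^ 2) := by
  have i1 := (hh.integrable hn).const_mul (1 + δ)
  have i2 := ((integrable_norm_sq_slice k).const_mul n).const_mul (1 + 1 / δ)
  rw [quadForm, quadForm, ← integral_norm_sq_slice, ← integral_const_mul, ← integral_const_mul,
    ← integral_const_mul, ← integral_add i1 i2]
  have hle : ∀ᵐ x ∂ν, curvForm (slice u x) (slice (h + k) x) (slice (h + k) x)
      ≤ (1 + δ) * curvForm (slice u x) (slice h x) (slice h x)
        + (1 + 1 / δ) * (n * ‖slice k x‖ ^ 2) := by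
    filter_upwards [slice_add h k, hk.curvForm_le hn] with x hx hkx
    rw [hx]
    refine (curvForm_add_self_le _ _ _ hδ).trans ?_
    gcongr
  refine integral_mono_of_nonneg (ae_of_all _ fun _ => curvForm_self_nonneg _ _) (i1.add i2) hle

theorem remainder_upper {n : ℝ} (hn : 0 < n) {u h : Lp ℝ 2 (ν.prod τ)}
    (ha : AwayFromZero n u h) (hb : ∀ᵐ x ∂ν, ‖slice h x‖ ≤ n) {t : ℝ} (ht : 0 < t)
    (htn : t * n ^ 2 < 1) :
    normIntegral (u + t • h) - normIntegral u - t * dirDeriv u h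
      ≤ t ^ 2 / 2 * (quadForm u h / (1 - t * n ^ 2)) := by
  rw [remainder_eq, quadForm, ← integral_div, ← integral_const_mul]
  refine integral_mono_ae (integrable_remainder u h t)
    (((ha.integrable hn).div_const _).const_mul _) ?_
  filter_upwards [ha, hb] with x hx hbx
  have hD : 0 < 1 - t * n ^ 2 := by linarith
  have hc := curvForm_self_nonneg (slice u x) (slice h x)
  by_cases h0 : slice u x = 0
  · simp [h0, curvForm_zero_left, normDeriv_zero_left, norm_smul, abs_of_pos ht]
  by_cases h1 : slice h x = 0
  · simp [h1, curvForm_zero_zero, normDeriv_zero_right]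
  have hA := norm_pos_iff.2 h0
  have h2 := mul_le_mul_of_nonneg_left (hx h0 h1) hn.le
  rw [mul_one_div_cancel hn.ne'] at h2
  have h3 : t * ‖slice h x‖ ≤ t * n ^ 2 * ‖slice u x‖ := by
    calc t * ‖slice h x‖ ≤ t * n * 1 := by rw [mul_one]; gcongr
      _ ≤ t * n * (n * ‖slice u x‖) := by gcongr
      _ = _ := by ring
  have h4 : t * ‖slice h x‖ < ‖slice u x‖ := by nlinarith
  refine (norm_remainder_upper ht.le h4).trans ?_
  rw [div_eq_mul_one_div (curvForm _ _ _)]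
  refine mul_le_mul_of_nonneg_left (mul_le_mul_of_nonneg_left ?_ hc) (by positivity)
  rw [div_le_div_iff₀ (by linarith) hD]
  nlinarith

end Expansion

/-! ### Weak convergence, tangent cones and second-order quotients in Hilbert spaces -/

section Hilbert

variable {X : Type*} [NormedAddCommGroup X] [InnerProductSpace ℝ X]

theorem WeakConv.mem_of_frequently {h : ℕ → X} {h₀ : X} (hw : WeakConv h h₀) {K : Set X}
    (hK : Convex ℝ K) (hc : IsClosed K) (hf : ∃ᶠ k in atTop, h k ∈ K) : h₀ ∈ K := by
  by_contra hn
  obtain ⟨φ, s, h1, h2⟩ := geometric_hahn_banach_closed_point hK hc hn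
  obtain ⟨k, hk, hk'⟩ := (hf.and_eventually ((hw φ).eventually_const_lt h2)).exists
  exact absurd (h1 _ hk) (not_lt.2 hk'.le)

theorem WeakConv.exists_norm_le [CompleteSpace X] {h : ℕ → X} {h₀ : X} (hw : WeakConv h h₀) :
    ∃ C, ∀ k, ‖h k‖ ≤ C := by
  obtain ⟨C, hC⟩ := banach_steinhaus (g := fun k => innerSL ℝ (h k)) (fun x => by
    obtain ⟨C, hC⟩ := ((hw (innerSL ℝ x)).norm.bddAbove_range)
    refine ⟨C, fun k => ?_⟩
    have := hC (Set.mem_range_self k)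
    rw [innerSL_apply_apply] at this ⊢
    rwa [real_inner_comm])
  exact ⟨C, fun k => by simpa using hC k⟩

theorem weakConv_of_tendsto {h : ℕ → X} {h₀ : X} (hh : Tendsto h atTop (𝓝 h₀)) :
    WeakConv h h₀ := fun φ => (φ.continuous.tendsto h₀).comp hh

/-- The cone of feasible directions. -/
def feasibleCone (U : Set X) (x : X) : Set X := {v | ∃ t : ℝ, 0 < t ∧ x + t • v ∈ U}

theorem add_smul_mem_of_le {U : Set X} (hU : Convex ℝ U) {x v : X} (hx : x ∈ U) {s t : ℝ}
    (ht : 0 < t) (hv : x + t • v ∈ U) (hs : 0 ≤ s) (hst : s ≤ t) : x + s • v ∈ U := by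
  have := hU.add_smul_mem hx hv (t := s / t) ⟨by positivity, div_le_one_of_le₀ hst ht.le⟩
  rwa [smul_smul, div_mul_cancel₀ _ ht.ne'] at this

theorem convex_feasibleCone {U : Set X} (hU : Convex ℝ U) {x : X} (hx : x ∈ U) :
    Convex ℝ (feasibleCone U x) := by
  rintro v ⟨s, hs, hv⟩ w ⟨t, ht, hw⟩ a b ha hb hab
  refine ⟨min s t, lt_min hs ht, ?_⟩
  have h1 := add_smul_mem_of_le hU hx hs hv (lt_min hs ht).le (min_le_left _ _)
  have h2 := add_smul_mem_of_le hU hx ht hw (lt_min hs ht).le (min_le_right _ _)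
  have h3 := hU h1 h2 ha hb hab
  convert h3 using 1
  rw [smul_add, smul_add, smul_add, smul_comm a, smul_comm b, add_add_add_comm, ← add_smul, hab,
    one_smul]

omit [InnerProductSpace ℝ X] in
/-- A recovery sequence exists if, for all small `t`, there are points near `h` at which the
quotient is not much larger than `c`. -/
theorem exists_recovery {q : ℝ → X → EReal} {h : X} {c : ℝ} {t : ℕ → ℝ} (ht : StepsToZero t)
    (H : ∀ ε > 0, ∀ᶠ s in 𝓝[>] (0 : ℝ), ∃ g : X, ‖g - h‖ < ε ∧ q s g ≤ ((c + ε : ℝ) : EReal)) :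
    ∃ g : ℕ → X, Tendsto g atTop (𝓝 h) ∧
      ∀ ε > 0, ∀ᶠ k in atTop, q (t k) (g k) ≤ ((c + ε : ℝ) : EReal) := by
  classical
  have htt : Tendsto t atTop (𝓝[>] 0) :=
    tendsto_nhdsWithin_iff.2 ⟨ht.2, Eventually.of_forall ht.1⟩
  -- `g k` is chosen for the best precision `1 / (n + 1)`, `n ≤ k`, available at `t k`
  let P : ℕ → ℕ → Prop := fun k n => ∃ g : X, ‖g - h‖ < 1 / ((n : ℝ) + 1) ∧
    q (t k) g ≤ ((c + 1 / ((n : ℝ) + 1) : ℝ) : EReal)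
  have hP : ∀ n, ∀ᶠ k in atTop, P k n := fun n => htt.eventually (H _ (by positivity))
  let N : ℕ → ℕ := fun k => Nat.findGreatest (P k) k
  let g : ℕ → X := fun k => if hk : P k (N k) then hk.choose else h
  have key : ∀ n : ℕ, ∀ᶠ k in atTop, ‖g k - h‖ < 1 / ((n : ℝ) + 1) ∧
      q (t k) (g k) ≤ ((c + 1 / ((n : ℝ) + 1) : ℝ) : EReal) := by
    intro n
    filter_upwards [hP n, eventually_ge_atTop n] with k hk hnk
    have h1 : P k (N k) := Nat.findGreatest_spec hnk hk
    have h2 : n ≤ N k := Nat.le_findGreatest hnk hk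
    have h3 : g k = h1.choose := dif_pos h1
    have h4 : 1 / ((N k : ℝ) + 1) ≤ 1 / ((n : ℝ) + 1) := by gcongr
    rw [h3]
    refine ⟨h1.choose_spec.1.trans_le h4, h1.choose_spec.2.trans ?_⟩
    exact_mod_cast add_le_add_right h4 c
  refine ⟨g, ?_, fun ε hε => ?_⟩
  · rw [Metric.tendsto_atTop']
    intro ε hε
    obtain ⟨n, hn⟩ := exists_nat_one_div_lt hε
    obtain ⟨K, hK⟩ := eventually_atTop.1 (key n)
    exact ⟨K, fun k hk => by rw [dist_eq_norm]; exact (hK k hk.le).1.trans hn⟩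
  · obtain ⟨n, hn⟩ := exists_nat_one_div_lt hε
    filter_upwards [key n] with k hk
    exact hk.2.trans (by exact_mod_cast add_le_add_right hn.le c)

/-- A lower bound along weakly convergent sequences together with approximate recovery yields
the weak second subderivative and a strongly convergent recovery sequence. -/
theorem secondSubderiv_eq_of_bounds {G : X → EReal} {x w h : X} {c : ℝ≥0∞}
    (hlow : ∀ (t : ℕ → ℝ) (hs : ℕ → X), StepsToZero t → WeakConv hs h →
      (c : EReal) ≤ liminf (fun k => secondQuotient G x w (t k) (hs k)) atTop)
    (hup : c ≠ ∞ → ∀ ε > 0, ∀ᶠ s in 𝓝[>] (0 : ℝ), ∃ g : X, ‖g - h‖ < ε ∧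
      secondQuotient G x w s g ≤ ((c.toReal + ε : ℝ) : EReal)) :
    secondSubderiv G x w h = c ∧ StronglyTwiceEpiDiffInDir G x w h := by
  have hrec : ∀ t : ℕ → ℝ, StepsToZero t → ∃ hs : ℕ → X, Tendsto hs atTop (𝓝 h) ∧
      Tendsto (fun k => secondQuotient G x w (t k) (hs k)) atTop (𝓝 (c : EReal)) := by
    intro t ht
    by_cases hc : c = ∞
    · refine ⟨fun _ => h, tendsto_const_nhds, ?_⟩
      have h1 := hlow t _ ht (weakConv_of_tendsto tendsto_const_nhds)
      exact tendsto_of_le_liminf_of_limsup_le h1 (by simp [hc])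
    · obtain ⟨g, hg, hgq⟩ := exists_recovery ht (hup hc)
      refine ⟨g, hg, tendsto_of_le_liminf_of_limsup_le (hlow t g ht (weakConv_of_tendsto hg)) ?_⟩
      have e : (c : EReal) = ((c.toReal : ℝ) : EReal) := by
        rw [← EReal.coe_toReal (x := (c : EReal)) (by simpa using hc) (by simp)]
        simp
      rw [e]
      refine EReal.le_of_forall_lt_iff_le.1 fun z hz => ?_
      have hz' : c.toReal < z := by exact_mod_cast hz
      refine limsup_le_of_le (by isBoundedDefault) ?_
      filter_upwards [hgq (z - c.toReal) (by linarith)] with k hk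
      simpa using hk
  have hval : secondSubderiv G x w h = c := by
    apply le_antisymm
    · have ht : StepsToZero fun k : ℕ => 1 / ((k : ℝ) + 1) :=
        ⟨fun k => by positivity, tendsto_one_div_add_atTop_nhds_zero_nat⟩
      obtain ⟨hs, h1, h2⟩ := hrec _ ht
      exact sInf_le ⟨_, hs, ht, weakConv_of_tendsto h1, h2.liminf_eq.symm⟩
    · refine le_sInf ?_
      rintro q ⟨t, hs, ht, hw, rfl⟩
      exact hlow t hs ht hw
  refine ⟨hval, fun t ht => ?_⟩
  rw [hval]
  exact hrec t ht

end Hilbert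

/-! ### The functional `G₃` and its first-order conditions -/

section Cylinder

variable {d : ℕ} {Ω : Set (EuclideanSpace ℝ (Fin d))} {T : ℝ}

theorem sliceNorm_eq (u : L2 Ω T) (x : EuclideanSpace ℝ (Fin d)) :
    sliceNorm u x = ‖slice u x‖ := (norm_slice u x).symm

theorem j₃_eq (u : L2 Ω T) : j₃ u = normIntegral u := by
  simp only [j₃, normIntegral, sliceNorm_eq]

theorem mem_Uad_add_smul_iff {α β : ℝ} {u h : L2 Ω T} {t : ℝ} :
    u + t • h ∈ Uad Ω T α β ↔ ∀ᵐ p ∂cylMeasure Ω T, α ≤ u p + t * h p ∧ u p + t * h p ≤ β := by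
  have e : ∀ᵐ p ∂cylMeasure Ω T, (u + t • h : L2 Ω T) p = u p + t * h p := by
    filter_upwards [Lp.coeFn_add u (t • h), Lp.coeFn_smul t h] with p h1 h2
    rw [h1, Pi.add_apply, h2, Pi.smul_apply, smul_eq_mul]
  constructor
  · intro hm
    filter_upwards [e, hm] with p h1 h2
    rwa [h1] at h2
  · intro hm
    change ∀ᵐ p ∂cylMeasure Ω T, _
    filter_upwards [e, hm] with p h1 h2
    rwa [h1]

theorem convex_Uad (α β : ℝ) : Convex ℝ (Uad Ω T α β) := by
  intro f hf g hg a b ha hb hab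
  change ∀ᵐ p ∂cylMeasure Ω T, _
  filter_upwards [hf, hg, Lp.coeFn_add (a • f) (b • g), Lp.coeFn_smul a f,
    Lp.coeFn_smul b g] with p h1 h2 h3 h4 h5
  rw [h3, Pi.add_apply, h4, h5, Pi.smul_apply, Pi.smul_apply]
  exact convex_Icc α β h1 h2 ha hb hab

theorem G₃_of_mem {α β : ℝ} (μ : ℝ) {u : L2 Ω T} (hu : u ∈ Uad Ω T α β) :
    G₃ α β μ u = ((μ * normIntegral u : ℝ) : EReal) := by
  rw [G₃, if_pos hu, zero_add, j₃_eq]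

theorem G₃_of_notMem {α β : ℝ} (μ : ℝ) {u : L2 Ω T} (hu : u ∉ Uad Ω T α β) :
    G₃ α β μ u = ⊤ := by
  rw [G₃, if_neg hu, EReal.top_add_coe]

theorem secondQuotient_of_mem {α β μ : ℝ} {u w h : L2 Ω T} {t : ℝ} (hu : u ∈ Uad Ω T α β)
    (hh : u + t • h ∈ Uad Ω T α β) :
    secondQuotient (G₃ α β μ) u w t h
      = (((μ * (normIntegral (u + t • h) - normIntegral u) - t * inner ℝ w h) / (t ^ 2 / 2) : ℝ) :
        EReal) := by
  rw [secondQuotient, G₃_of_mem μ hu, G₃_of_mem μ hh]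
  rw [← EReal.coe_sub, ← EReal.coe_sub, ← EReal.coe_div, mul_sub]

theorem secondQuotient_of_notMem {α β μ : ℝ} {u w h : L2 Ω T} {t : ℝ} (ht : 0 < t)
    (hu : u ∈ Uad Ω T α β) (hh : u + t • h ∉ Uad Ω T α β) :
    secondQuotient (G₃ α β μ) u w t h = ⊤ := by
  rw [secondQuotient, G₃_of_mem μ hu, G₃_of_notMem μ hh, EReal.top_sub_coe, EReal.top_sub_coe]
  exact EReal.top_div_of_pos_ne_top (by exact_mod_cast (by positivity : 0 < t ^ 2 / 2))
    (EReal.coe_ne_top _)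

/-- A direction is feasible if, at almost every point, a fixed step is admissible, or `u` vanishes
and the direction obeys a fixed bound. -/
theorem mem_feasibleCone {α β : ℝ} (hα : α < 0) (hβ : 0 < β) {u h : L2 Ω T}
    (hu : u ∈ Uad Ω T α β) {s M : ℝ} (hs : 0 < s) (hM : 0 ≤ M)
    (hh : ∀ᵐ p ∂cylMeasure Ω T,
      (u p = 0 ∧ |h p| ≤ M) ∨ (α ≤ u p + s * h p ∧ u p + s * h p ≤ β)) :
    h ∈ feasibleCone (Uad Ω T α β) u := by
  set r := min (-α) β / (M + 1)
  have hmin : 0 < min (-α) β := lt_min (by linarith) hβ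
  have hr : 0 < r := by positivity
  have hpos : 0 < min s r := lt_min hs hr
  refine ⟨min s r, hpos, mem_Uad_add_smul_iff.2 ?_⟩
  filter_upwards [hu, hh] with p h1 h2
  rcases h2 with ⟨h0, hb⟩ | h2
  · have h3 : |min s r * h p| ≤ min (-α) β := by
      rw [abs_mul, abs_of_pos hpos]
      calc min s r * |h p| ≤ r * (M + 1) := by
            gcongr
            · exact min_le_right _ _
            · linarith
        _ = min (-α) β := div_mul_cancel₀ _ (by positivity)
    have h4 := abs_le.1 h3
    have h5 := min_le_left (-α) β
    have h6 := min_le_right (-α) β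
    rw [h0]
    constructor <;> linarith
  · have h3 : min s r / s ≤ 1 := div_le_one_of_le₀ (min_le_left _ _) hs.le
    have h4 := (convex_Icc α β).add_smul_sub_mem (x := u p) (y := u p + s * h p) h1 h2
      (t := min s r / s) ⟨by positivity, h3⟩
    have e : u p + (min s r / s) • (u p + s * h p - u p) = u p + min s r * h p := by
      rw [smul_eq_mul]; field_simp; ring
    rw [e] at h4
    exact h4

theorem cut_mem_convexTangentCone {α β : ℝ} {u v : L2 Ω T} (hu : u ∈ Uad Ω T α β)
    (hv : v ∈ convexTangentCone (Uad Ω T α β) u)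
    {E : Set (EuclideanSpace ℝ (Fin d) × ℝ)} (hE : MeasurableSet E) :
    cut hE v ∈ convexTangentCone (Uad Ω T α β) u := by
  refine map_mem_closure (continuous_cut hE) hv ?_
  rintro f ⟨t, ht, hf⟩
  refine ⟨t, ht, mem_Uad_add_smul_iff.2 ?_⟩
  filter_upwards [hu, mem_Uad_add_smul_iff.1 hf, cut_coe hE f] with p h1 h2 h3
  rw [h3]
  by_cases hp : p ∈ E
  · simpa [hp] using h2
  · simpa [hp] using h1

/-- Tangent directions point inwards where a bound is active. -/
theorem sign_of_mem_convexTangentCone {α β : ℝ} {u v : L2 Ω T}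
    (hv : v ∈ convexTangentCone (Uad Ω T α β) u) :
    ∀ᵐ p ∂cylMeasure Ω T, (u p = α → 0 ≤ v p) ∧ (u p = β → v p ≤ 0) := by
  obtain ⟨f, hf, hlim⟩ := mem_closure_iff_seq_limit.1 hv
  have hfs : ∀ᵐ p ∂cylMeasure Ω T, ∀ n, (u p = α → 0 ≤ f n p) ∧ (u p = β → f n p ≤ 0) := by
    rw [ae_all_iff]
    intro n
    obtain ⟨t, ht, hm⟩ := hf n
    filter_upwards [mem_Uad_add_smul_iff.1 hm] with p hp
    constructor
    · intro h
      rw [h] at hp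
      exact nonneg_of_mul_nonneg_right (by linarith [hp.1]) ht
    · intro h
      rw [h] at hp
      have : 0 ≤ t * -f n p := by linarith [hp.2]
      linarith [nonneg_of_mul_nonneg_right this ht]
  obtain ⟨ns, -, hns⟩ := (tendstoInMeasure_of_tendsto_Lp hlim).exists_seq_tendsto_ae
  filter_upwards [hfs, hns] with p h1 h2
  exact ⟨fun h => ge_of_tendsto' h2 fun i => (h1 _).1 h,
    fun h => le_of_tendsto' h2 fun i => (h1 _).2 h⟩

/-- At almost every point, a tangent direction is admissible for small steps. -/
theorem eventually_admissible {α β : ℝ} {u v : L2 Ω T} (hu : u ∈ Uad Ω T α β)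
    (hv : v ∈ convexTangentCone (Uad Ω T α β) u) :
    ∀ᵐ p ∂cylMeasure Ω T, ∀ᶠ m : ℕ in atTop,
      α ≤ u p + 1 / ((m : ℝ) + 1) * v p ∧ u p + 1 / ((m : ℝ) + 1) * v p ≤ β := by
  filter_upwards [hu, sign_of_mem_convexTangentCone hv] with p h1 h2
  have hlim : Tendsto (fun m : ℕ => u p + 1 / ((m : ℝ) + 1) * v p) atTop (𝓝 (u p)) := by
    simpa using (tendsto_one_div_add_atTop_nhds_zero_nat.mul_const (v p)).const_add (u p)
  refine Eventually.and ?_ ?_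
  · rcases h1.1.eq_or_lt with h | h
    · refine Eventually.of_forall fun m => ?_
      have := h2.1 h.symm
      have : 0 ≤ 1 / ((m : ℝ) + 1) * v p := by positivity
      linarith
    · exact (hlim.eventually_const_lt h).mono fun _ h => h.le
  · rcases h1.2.eq_or_lt with h | h
    · refine Eventually.of_forall fun m => ?_
      have := h2.2 h
      have : 1 / ((m : ℝ) + 1) * v p ≤ 0 :=
        mul_nonpos_of_nonneg_of_nonpos (by positivity) this
      linarith
    · exact (hlim.eventually_lt_const h).mono fun _ h => h.le

theorem measurable_coe (u : L2 Ω T) : Measurable (u : EuclideanSpace ℝ (Fin d) × ℝ → ℝ) :=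
  (Lp.stronglyMeasurable u).measurable

variable [IsFiniteMeasure ((volume : Measure (EuclideanSpace ℝ (Fin d))).restrict Ω)]

theorem hasDirDeriv_dirDeriv (u v : L2 Ω T) : HasDirDeriv j₃ u v (dirDeriv u v) := by
  simp only [HasDirDeriv, j₃_eq]
  exact tendsto_normIntegral_quotient u v

theorem mem_criticalCone_iff {α β μ : ℝ} {u F' v : L2 Ω T} :
    v ∈ criticalCone α β μ u F' ↔
      v ∈ convexTangentCone (Uad Ω T α β) u ∧ inner ℝ (-F') v = μ * dirDeriv u v := by
  rw [inner_neg_left]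
  constructor
  · rintro ⟨h1, δ, h2, h3⟩
    have := tendsto_nhds_unique h2 (hasDirDeriv_dirDeriv u v)
    exact ⟨h1, by rw [← this]; linarith⟩
  · rintro ⟨h1, h2⟩
    exact ⟨h1, _, hasDirDeriv_dirDeriv u v, by linarith⟩

/-- The first-order optimality condition that a subgradient encodes. -/
theorem inner_le_dirDeriv {α β μ : ℝ} {u w v : L2 Ω T} (hu : u ∈ Uad Ω T α β)
    (hw : w ∈ subdiff (G₃ α β μ) u) (hv : v ∈ convexTangentCone (Uad Ω T α β) u) :
    inner ℝ w v ≤ μ * dirDeriv u v := by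
  have hcl : IsClosed {v : L2 Ω T | inner ℝ w v ≤ μ * dirDeriv u v} :=
    isClosed_le (continuous_const.inner continuous_id)
      (continuous_const.mul (continuous_dirDeriv u))
  refine closure_minimal ?_ hcl hv
  rintro f ⟨t, ht, hf⟩
  have hlim := (tendsto_normIntegral_quotient u f).const_mul μ
  refine ge_of_tendsto hlim ?_
  filter_upwards [Ioo_mem_nhdsGT ht] with s hs
  have hs0 : 0 < s := hs.1
  have hm := add_smul_mem_of_le (convex_Uad α β) hu ht hf hs.1.le hs.2.le
  have h1 := hw (u + s • f)
  rw [G₃_of_mem μ hu, G₃_of_mem μ hm, add_sub_cancel_left, inner_smul_right] at h1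
  have h2 : μ * normIntegral u + s * inner ℝ w f ≤ μ * normIntegral (u + s • f) := by
    exact_mod_cast h1
  rw [← mul_div_assoc, le_div_iff₀ hs0]
  linarith

/-- If the second-order quotients do not tend to infinity along a weakly convergent sequence, then
its limit is critical. -/
theorem critical_of_frequently_le {α β μ : ℝ} (hμ : 0 < μ) {u w v : L2 Ω T}
    (hu : u ∈ Uad Ω T α β) (hw : w ∈ subdiff (G₃ α β μ) u) {t : ℕ → ℝ} {vs : ℕ → L2 Ω T}
    (ht : StepsToZero t) (hvs : WeakConv vs v) {C : ℝ}
    (hf : ∃ᶠ k in atTop, secondQuotient (G₃ α β μ) u w (t k) (vs k) ≤ (C : EReal)) :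
    v ∈ convexTangentCone (Uad Ω T α β) u ∧ inner ℝ w v = μ * dirDeriv u v := by
  have hmem : ∀ k, secondQuotient (G₃ α β μ) u w (t k) (vs k) ≤ (C : EReal) →
      u + t k • vs k ∈ Uad Ω T α β := by
    intro k hk
    by_contra hn
    rw [secondQuotient_of_notMem (ht.1 k) hu hn] at hk
    exact EReal.coe_ne_top C (top_le_iff.1 hk)
  have hT : v ∈ convexTangentCone (Uad Ω T α β) u :=
    hvs.mem_of_frequently (convex_feasibleCone (convex_Uad α β) hu).closure isClosed_closure
      (hf.mono fun k hk => subset_closure ⟨t k, ht.1 k, hmem k hk⟩)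
  refine ⟨hT, le_antisymm (inner_le_dirDeriv hu hw hT) ?_⟩
  refine le_of_forall_pos_le_add fun ε hε => ?_
  have hcl : IsClosed {v : L2 Ω T | μ * dirDeriv u v - inner ℝ w v ≤ ε} :=
    isClosed_le ((continuous_const.mul (continuous_dirDeriv u)).sub
      (continuous_const.inner continuous_id)) continuous_const
  have hconv : Convex ℝ {v : L2 Ω T | μ * dirDeriv u v - inner ℝ w v ≤ ε} := by
    have h1 : ConvexOn ℝ Set.univ fun v : L2 Ω T => μ * dirDeriv u v - inner ℝ w v :=
      ((convexOn_dirDeriv u).smul hμ.le).sub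
        ((innerSL ℝ w).toLinearMap.concaveOn convex_univ)
    simpa using h1.convex_le ε
  have hlim : Tendsto (fun k => t k * C / 2) atTop (𝓝 0) := by
    simpa using (ht.2.mul_const C).div_const 2
  have : v ∈ {v : L2 Ω T | μ * dirDeriv u v - inner ℝ w v ≤ ε} := by
    refine hvs.mem_of_frequently hconv hcl
      ((hf.and_eventually (hlim.eventually_lt_const hε)).mono ?_)
    rintro k ⟨hk, hkε⟩
    have htk := ht.1 k
    have hm := hmem k hk
    rw [secondQuotient_of_mem hu hm] at hk
    have hk' := EReal.coe_le_coe_iff.1 hk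
    rw [div_le_iff₀ (by positivity)] at hk'
    have h2 := mul_le_mul_of_nonneg_left (mul_dirDeriv_le u (vs k) htk.le) hμ.le
    have h3 : t k * (μ * dirDeriv u (vs k) - inner ℝ w (vs k)) ≤ t k * (t k * C / 2) := by
      nlinarith
    have h4 := le_of_mul_le_mul_left h3 htk
    exact h4.trans hkε.le
  have h5 : μ * dirDeriv u v - inner ℝ w v ≤ ε := this
  linarith

end Cylinder

/-! ### Lower bound for the second-order quotients -/

section SecondOrder

variable {d : ℕ} {Ω : Set (EuclideanSpace ℝ (Fin d))} {T : ℝ}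
  [IsFiniteMeasure ((volume : Measure (EuclideanSpace ℝ (Fin d))).restrict Ω)]

theorem curvature_eq {μ : ℝ} (hμ : 0 < μ) (u v : L2 Ω T) :
    curvature μ u v = ENNReal.ofReal μ *
      ∫⁻ x in Ω, ENNReal.ofReal (curvForm (slice u x) (slice v x) (slice v x)) := by
  have hms : MeasurableSet {x : EuclideanSpace ℝ (Fin d) | ‖slice u x‖ ≠ 0} :=
    (measurable_norm_slice u (measurableSet_singleton 0)).compl
  have hset : activeSet u = {x | ‖slice u x‖ ≠ 0} ∩ Ω := by
    ext x
    simp only [activeSet, sliceNorm_eq, Set.mem_ofPred_eq, Set.mem_inter_iff, and_comm]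
  rw [curvature, hset, ← Measure.restrict_restrict hms, ← lintegral_indicator hms,
    ← lintegral_const_mul' _ _ ENNReal.ofReal_ne_top]
  apply lintegral_congr_ae
  filter_upwards [inner_slice u v, inner_slice v v] with x h1 h2
  rw [← ENNReal.ofReal_mul hμ.le]
  by_cases hx : slice u x = 0
  · simp [hx, curvForm_zero_left]
  rw [Set.indicator_of_mem (by simpa using hx)]
  congr 1
  rw [curvIntegrand, curvForm, sliceNorm_eq, h1, h2, integral_div]
  simp_rw [sq]
  ring

theorem curvature_le_liminf {α β μ : ℝ} (hμ : 0 < μ) {u w v : L2 Ω T}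
    (hu : u ∈ Uad Ω T α β) (hw : w ∈ subdiff (G₃ α β μ) u) {t : ℕ → ℝ} {vs : ℕ → L2 Ω T}
    (ht : StepsToZero t) (hvs : WeakConv vs v) :
    (curvature μ u v : EReal)
      ≤ liminf (fun k => secondQuotient (G₃ α β μ) u w (t k) (vs k)) atTop := by
  -- the affine minorants of the quotients, for every truncation parameter
  have key : ∀ (n : ℝ) (hn : 0 < n) (z : ℝ), z < μ * curvFunctional hn u v v →
      (z : EReal) ≤ liminf (fun k => secondQuotient (G₃ α β μ) u w (t k) (vs k)) atTop := by
    intro n hn z hz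
    obtain ⟨C, hC⟩ := hvs.exists_norm_le
    have hN : Tendsto (fun k => t k * n ^ 4 * normIntegral (vs k)) atTop (𝓝 0) := by
      set D := ((volume.restrict Ω).real Set.univ + 1) / 2 * C
      have hlim : Tendsto (fun k => t k * n ^ 4 * D) atTop (𝓝 0) := by
        simpa using (ht.2.mul_const (n ^ 4)).mul_const D
      refine squeeze_zero (fun k => ?_) (fun k => ?_) hlim
      · have := (ht.1 k).le
        have := normIntegral_nonneg (vs k)
        positivity
      · have := (ht.1 k).le
        refine mul_le_mul_of_nonneg_left ((normIntegral_le (vs k)).trans ?_) (by positivity)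
        exact mul_le_mul_of_nonneg_left (hC k) (by positivity)
    have hlim : Tendsto (fun k => μ * (2 * curvFunctional hn u v (vs k)
        - curvFunctional hn u v v - t k * n ^ 4 * normIntegral (vs k))) atTop
        (𝓝 (μ * (2 * curvFunctional hn u v v - curvFunctional hn u v v - 0))) :=
      ((((hvs (curvFunctional hn u v)).const_mul 2).sub_const _).sub hN).const_mul μ
    refine le_liminf_of_le (by isBoundedDefault) ?_
    have e : μ * (2 * curvFunctional hn u v v - curvFunctional hn u v v - 0)
        = μ * curvFunctional hn u v v := by ring
    rw [e] at hlim
    filter_upwards [hlim.eventually_const_lt hz] with k hk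
    have htk := ht.1 k
    by_cases hm : u + t k • vs k ∈ Uad Ω T α β
    · rw [secondQuotient_of_mem hu hm, EReal.coe_le_coe_iff, le_div_iff₀ (by positivity)]
      have h1 := mul_le_mul_of_nonneg_left (remainder_lower hn u v (vs k) htk.le) hμ.le
      have h2 := inner_le_dirDeriv hu hw (subset_closure ⟨t k, htk, hm⟩ :
        vs k ∈ convexTangentCone (Uad Ω T α β) u)
      have h3 := mul_le_mul_of_nonneg_left h2 htk.le
      have h4 := mul_le_mul_of_nonneg_right hk.le (by positivity : 0 ≤ t k ^ 2 / 2)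
      linarith
    · rw [secondQuotient_of_notMem htk hu hm]
      exact le_top
  refine EReal.ge_of_forall_gt_iff_ge.1 fun z hz => ?_
  rcases lt_or_ge z 0 with hneg | hpos
  · refine key 1 one_pos z (hneg.trans_le ?_)
    exact mul_nonneg hμ.le (integral_nonneg fun _ => curvForm_self_nonneg _ _)
  · have hz' : ENNReal.ofReal z < curvature μ u v := by
      rw [← EReal.coe_ennreal_lt_coe_ennreal_iff, EReal.coe_ennreal_ofReal, max_eq_left hpos]
      exact hz
    rw [curvature_eq hμ, mul_comm] at hz'
    have h0 : ENNReal.ofReal μ ≠ 0 := by simpa using hμ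
    have h1 := ENNReal.div_lt_of_lt_mul hz'
    obtain ⟨n, hn, h2⟩ := exists_lt_curvFunctional h1
    refine key n hn z ?_
    rw [ENNReal.div_lt_iff (Or.inl h0) (Or.inl ENNReal.ofReal_ne_top), mul_comm,
      ← ENNReal.ofReal_mul hμ.le] at h2
    exact (ENNReal.ofReal_lt_ofReal_iff_of_nonneg hpos).1 h2

/-! ### Structure of critical directions -/

/-- Equality in the first-order condition localizes to sets that do not split the slices on which
`u` vanishes. -/
theorem inner_cut_eq {α β μ : ℝ} {u w v : L2 Ω T} (hu : u ∈ Uad Ω T α β)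
    (hw : w ∈ subdiff (G₃ α β μ) u) (hv : v ∈ convexTangentCone (Uad Ω T α β) u)
    (hc : inner ℝ w v = μ * dirDeriv u v)
    {E : Set (EuclideanSpace ℝ (Fin d) × ℝ)} (hE : MeasurableSet E)
    (hsplit : ∀ x, slice u x = 0 → (∀ y, (x, y) ∈ E) ∨ ∀ y, (x, y) ∉ E) :
    inner ℝ w (cut hE v) = μ * dirDeriv u (cut hE v) := by
  have h1 := inner_le_dirDeriv hu hw (cut_mem_convexTangentCone hu hv hE)
  have h2 := inner_le_dirDeriv hu hw (cut_mem_convexTangentCone hu hv hE.compl)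
  have h3 : dirDeriv u (cut hE v + cut hE.compl v)
      = dirDeriv u (cut hE v) + dirDeriv u (cut hE.compl v) := by
    apply dirDeriv_add_of_zero
    filter_upwards [slice_cut_of_notMem hE v, slice_cut_of_notMem hE.compl v] with x a1 a2 hx
    rcases hsplit x hx with h | h
    · exact Or.inr (a2 fun y hy => hy (h y))
    · exact Or.inl (a1 h)
  have h4 : inner ℝ w (cut hE v + cut hE.compl v)
      = (inner ℝ w (cut hE v) + inner ℝ w (cut hE.compl v) : ℝ) := inner_add_right _ _ _
  rw [cut_add_cut_compl] at h3 h4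
  rw [h3, h4] at hc
  linarith

theorem integrable_gap (μ : ℝ) (w h : L2 Ω T) :
    Integrable (fun x => μ * ‖slice h x‖ - inner ℝ (slice w x) (slice h x))
      (volume.restrict Ω) :=
  ((integrable_norm_slice h).const_mul μ).sub (integrable_inner_slice w h)

theorem gap_cut {A : Set (EuclideanSpace ℝ (Fin d))} (hA : MeasurableSet A) {u : L2 Ω T}
    (hAu : ∀ x ∈ A, slice u x = 0) (μ : ℝ) (w h : L2 Ω T) :
    μ * dirDeriv u (cut (hA.prod (MeasurableSet.univ (α := ℝ))) h)
        - inner ℝ w (cut (hA.prod MeasurableSet.univ) h)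
      = ∫ x in A, (μ * ‖slice h x‖ - inner ℝ (slice w x) (slice h x))
          ∂(volume.restrict Ω) := by
  set E := hA.prod (MeasurableSet.univ (α := ℝ))
  rw [dirDeriv, ← integral_inner_slice, ← integral_const_mul, ← integral_sub
    ((integrable_normDeriv u _).const_mul μ) (integrable_inner_slice w _),
    ← integral_indicator hA]
  apply integral_congr_ae
  filter_upwards [slice_cut_of_mem E h, slice_cut_of_notMem E h] with x h1 h2
  by_cases hx : x ∈ A
  · rw [h1 fun y => ⟨hx, trivial⟩, Set.indicator_of_mem hx, hAu x hx, normDeriv_zero_left]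
  · rw [h2 fun y hy => hx hy.1, Set.indicator_of_notMem hx, normDeriv_zero_right, inner_zero_right,
      mul_zero, sub_zero]

omit [IsFiniteMeasure ((volume : Measure (EuclideanSpace ℝ (Fin d))).restrict Ω)] in
theorem measurableSet_zeroSet (u : L2 Ω T) :
    MeasurableSet {x : EuclideanSpace ℝ (Fin d) | slice u x = 0} := by
  have := measurable_norm_slice u (measurableSet_singleton 0)
  simpa [Set.preimage] using this

theorem ae_eq_zero_of_slice_eq_zero (u : L2 Ω T) :
    ∀ᵐ p ∂cylMeasure Ω T, slice u p.1 = 0 → u p = 0 := by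
  have hms : MeasurableSet
      {p : EuclideanSpace ℝ (Fin d) × ℝ | slice u p.1 = 0 → u p = 0} := by
    have h1 : MeasurableSet (Prod.fst ⁻¹' {x | slice u x = 0} :
        Set (EuclideanSpace ℝ (Fin d) × ℝ)) := measurable_fst (measurableSet_zeroSet u)
    have h2 := measurable_coe u (measurableSet_singleton 0)
    have : {p : EuclideanSpace ℝ (Fin d) × ℝ | slice u p.1 = 0 → u p = 0}
        = (Prod.fst ⁻¹' {x | slice u x = 0})ᶜ ∪ u ⁻¹' {0} := by
      ext p; simp [imp_iff_not_or]
    rw [this]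
    exact h1.compl.union h2
  rw [Measure.ae_prod_iff_ae_ae hms]
  filter_upwards [slice_coe u] with x hx
  by_cases h0 : slice u x = 0
  · rw [h0] at hx
    filter_upwards [hx, Lp.coeFn_zero ℝ 2 (volume.restrict (Set.Ioo 0 T))] with y h1 h2 _
    rw [← h1, h2, Pi.zero_apply]
  · exact ae_of_all _ fun y h => absurd h h0

/-- Where `u` vanishes, a bounded subgradient is in the ball of radius `μ`. Boundedness ensures
that the subgradient itself, cut to such slices, is a feasible direction. -/
theorem norm_slice_subgradient_le {α β μ M : ℝ} (hα : α < 0) (hβ : 0 < β) (hμ : 0 < μ)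
    {u w : L2 Ω T} (hu : u ∈ Uad Ω T α β) (hw : w ∈ subdiff (G₃ α β μ) u) (hM0 : 0 ≤ M)
    (hM : ∀ᵐ p ∂cylMeasure Ω T, |w p| ≤ M) :
    ∀ᵐ x ∂(volume.restrict Ω), slice u x = 0 → ‖slice w x‖ ≤ μ := by
  set Z : Set (EuclideanSpace ℝ (Fin d)) := {x | slice u x = 0}
  have hZ : MeasurableSet Z := measurableSet_zeroSet u
  have hg := (integrable_gap μ w w).indicator hZ
  have hnn := ae_nonneg_of_forall_setIntegral_nonneg hg (fun A hA _ => by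
    rw [setIntegral_indicator hZ, ← gap_cut (u := u) (hA.inter hZ) (fun x hx => hx.2), sub_nonneg]
    refine inner_le_dirDeriv hu hw (subset_closure
      (mem_feasibleCone hα hβ hu (s := 1) one_pos hM0 ?_))
    filter_upwards [ae_eq_zero_of_slice_eq_zero u, hM, hu,
      cut_coe ((hA.inter hZ).prod (MeasurableSet.univ (α := ℝ))) w] with p h1 h2 h3 h4
    rw [h4]
    by_cases hp : p ∈ (A ∩ Z) ×ˢ (Set.univ : Set ℝ)
    · rw [Set.indicator_of_mem hp]
      exact Or.inl ⟨h1 hp.1.2, h2⟩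
    · rw [Set.indicator_of_notMem hp]
      exact Or.inr (by simpa using h3))
  filter_upwards [hnn] with x hx h0
  have hxZ : x ∈ Z := h0
  rw [Set.indicator_of_mem hxZ, real_inner_self_eq_norm_sq] at hx
  have hx' : 0 ≤ μ * ‖slice w x‖ - ‖slice w x‖ ^ 2 := hx
  by_contra hlt
  push Not at hlt
  have hpos := hμ.trans hlt
  nlinarith

/-- Where `u` vanishes, critical directions are nonnegative multiples of the subgradient. -/
theorem ae_eq_smul_subgradient {α β μ M : ℝ} (hα : α < 0) (hβ : 0 < β) (hμ : 0 < μ)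
    {u w v : L2 Ω T} (hu : u ∈ Uad Ω T α β) (hw : w ∈ subdiff (G₃ α β μ) u) (hM0 : 0 ≤ M)
    (hM : ∀ᵐ p ∂cylMeasure Ω T, |w p| ≤ M)
    (hv : v ∈ convexTangentCone (Uad Ω T α β) u) (hc : inner ℝ w v = μ * dirDeriv u v) :
    ∀ᵐ p ∂cylMeasure Ω T, slice u p.1 = 0 → v p = ‖slice v p.1‖ / μ * w p := by
  set Z : Set (EuclideanSpace ℝ (Fin d)) := {x | slice u x = 0}
  have hZ : MeasurableSet Z := measurableSet_zeroSet u
  have hg := (integrable_gap μ w v).indicator hZ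
  have hz := hg.ae_eq_zero_of_forall_setIntegral_eq_zero (fun A hA _ => by
    rw [setIntegral_indicator hZ, ← gap_cut (u := u) (hA.inter hZ) (fun x hx => hx.2), sub_eq_zero]
    refine (inner_cut_eq hu hw hv hc _ fun x _ => ?_).symm
    by_cases hx : x ∈ A ∩ Z
    · exact Or.inl fun y => ⟨hx, trivial⟩
    · exact Or.inr fun y hy => hx hy.1)
  have hms : MeasurableSet {p : EuclideanSpace ℝ (Fin d) × ℝ |
      slice u p.1 = 0 → v p = ‖slice v p.1‖ / μ * w p} := by
    have h1 : MeasurableSet (Prod.fst ⁻¹' Z : Set (EuclideanSpace ℝ (Fin d) × ℝ)) :=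
      measurable_fst hZ
    have h2 := measurableSet_eq_fun (measurable_coe v)
      ((((measurable_norm_slice v).comp (measurable_fst (β := ℝ))).div_const μ).mul
        (measurable_coe w))
    have : {p : EuclideanSpace ℝ (Fin d) × ℝ |
        slice u p.1 = 0 → v p = ‖slice v p.1‖ / μ * w p}
        = (Prod.fst ⁻¹' Z)ᶜ ∪ {p | v p = ‖slice v p.1‖ / μ * w p} := by
      ext p; simp [Z, imp_iff_not_or]
    rw [this]
    exact h1.compl.union h2
  rw [Measure.ae_prod_iff_ae_ae hms]
  filter_upwards [hz, norm_slice_subgradient_le hα hβ hμ hu hw hM0 hM, slice_coe v, slice_coe w]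
    with x h1 h2 h3 h4
  by_cases h0 : slice u x = 0
  · have hxZ : x ∈ Z := h0
    rw [Set.indicator_of_mem hxZ, Pi.zero_apply, sub_eq_zero] at h1
    have h5 := eq_smul_of_inner_eq hμ (h2 h0) h1
    have h6 := Lp.coeFn_smul (‖slice v x‖ / μ) (slice w x)
    rw [← h5] at h6
    filter_upwards [h3, h4, h6] with y e3 e4 e6 _
    rw [← e3, e6, Pi.smul_apply, smul_eq_mul, e4]
  · exact ae_of_all _ fun y h => absurd h h0

end SecondOrder

/-! ### Recovery of critical directions -/

section AwayFromZero

variable {X Y : Type*} [MeasurableSpace X] [MeasurableSpace Y] {ν : Measure X} {τ : Measure Y}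
  [IsFiniteMeasure ν] [IsFiniteMeasure τ]

theorem AwayFromZero.cut {n : ℝ} {u h : Lp ℝ 2 (ν.prod τ)} (ha : AwayFromZero n u h)
    {E : Set (X × Y)} (hE : MeasurableSet E) : AwayFromZero n u (cut hE h) := by
  filter_upwards [ha, norm_slice_cut_le hE h] with x h1 h2 h3 h4
  refine h1 h3 fun h0 => h4 ?_
  rw [h0, norm_zero] at h2
  exact norm_le_zero_iff.1 h2

theorem AwayFromZero.sub {n : ℝ} {u h k : Lp ℝ 2 (ν.prod τ)} (hh : AwayFromZero n u h)
    (hk : AwayFromZero n u k) : AwayFromZero n u (h - k) := by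
  filter_upwards [hh, hk, slice_sub h k] with x h1 h2 h3 h4 h5
  by_cases h6 : slice h x = 0
  · refine h2 h4 fun h7 => h5 ?_
    rw [h3, h6, h7, sub_zero]
  · exact h1 h4 h6

theorem tendsto_quadForm_cut {n : ℝ} (hn : 0 < n) {u h : Lp ℝ 2 (ν.prod τ)}
    (ha : AwayFromZero n u h) {E : ℕ → Set (X × Y)} (hE : ∀ m, MeasurableSet (E m))
    (hlim : Tendsto (fun m => SparseControl.cut (hE m) h) atTop (𝓝 h)) {ε : ℝ} (hε : 0 < ε) :
    ∀ᶠ m in atTop, quadForm u (SparseControl.cut (hE m) h) < quadForm u h + ε := by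
  have hQ := quadForm_nonneg u h
  -- half of `ε` pays for the factor `1 + δ`, the other half for the perturbation
  set δ := ε / (2 * (quadForm u h + 1)) with hδdef
  have hδ : 0 < δ := by positivity
  have h1 : δ * quadForm u h < ε / 2 := by
    rw [hδdef, div_mul_eq_mul_div, div_lt_div_iff₀ (by positivity) two_pos]
    nlinarith
  have h2 : Tendsto (fun m => (1 + 1 / δ) * (n * ‖SparseControl.cut (hE m) h - h‖ ^ 2)) atTop
      (𝓝 0) := by
    have := tendsto_iff_norm_sub_tendsto_zero.1 hlim
    simpa using ((this.pow 2).const_mul n).const_mul (1 + 1 / δ)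
  filter_upwards [h2.eventually_lt_const (half_pos hε)] with m hm
  have h3 := quadForm_add_le hn ha ((ha.cut (hE m)).sub ha) hδ
  rw [add_sub_cancel] at h3
  linarith

end AwayFromZero

section Recovery

variable {d : ℕ} {Ω : Set (EuclideanSpace ℝ (Fin d))} {T : ℝ}
  [IsFiniteMeasure ((volume : Measure (EuclideanSpace ℝ (Fin d))).restrict Ω)]

/-- For feasible critical directions that avoid small slices of `u` and large slices, the
quotients are asymptotically bounded by the curvature. -/
theorem eventually_secondQuotient_le {α β μ : ℝ} (hμ : 0 < μ) {u w h : L2 Ω T}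
    (hu : u ∈ Uad Ω T α β) (hf : h ∈ feasibleCone (Uad Ω T α β) u)
    (hc : inner ℝ w h = μ * dirDeriv u h) {n : ℝ} (hn : 0 < n) (ha : AwayFromZero n u h)
    (hb : ∀ᵐ x ∂(volume.restrict Ω), ‖slice h x‖ ≤ n) {b : ℝ} (hq : μ * quadForm u h < b) :
    ∀ᶠ t in 𝓝[>] (0 : ℝ), secondQuotient (G₃ α β μ) u w t h ≤ (b : EReal) := by
  obtain ⟨s, hs, hsU⟩ := hf
  have hlim : Tendsto (fun t : ℝ => μ * (quadForm u h / (1 - t * n ^ 2))) (𝓝[>] 0)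
      (𝓝 (μ * quadForm u h)) := by
    have : ContinuousAt (fun t : ℝ => μ * (quadForm u h / (1 - t * n ^ 2))) 0 := by
      have : 1 - 0 * n ^ 2 ≠ 0 := by simp
      fun_prop (disch := assumption)
    simpa using this.tendsto.mono_left nhdsWithin_le_nhds
  have hsmall : (0 : ℝ) < 1 / n ^ 2 := by positivity
  filter_upwards [hlim.eventually_lt_const hq, Ioo_mem_nhdsGT hs, Ioo_mem_nhdsGT hsmall]
    with t h1 h2 h3
  have ht : 0 < t := h2.1
  have htn : t * n ^ 2 < 1 := (lt_div_iff₀ (by positivity)).1 h3.2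
  have hm := add_smul_mem_of_le (convex_Uad α β) hu hs hsU ht.le h2.2.le
  rw [secondQuotient_of_mem hu hm, EReal.coe_le_coe_iff, div_le_iff₀ (by positivity)]
  have h4 := mul_le_mul_of_nonneg_left (remainder_upper hn ha hb ht htn) hμ.le
  have h5 := mul_le_mul_of_nonneg_right h1.le (by positivity : 0 ≤ t ^ 2 / 2)
  rw [hc]
  linarith

/-- The slices on which `u` vanishes or is not small, and `v` is not large. -/
def goodSlices (n : ℝ) (u v : L2 Ω T) : Set (EuclideanSpace ℝ (Fin d)) :=
  {x | (slice u x = 0 ∨ 1 / n ≤ ‖slice u x‖) ∧ ‖slice v x‖ ≤ n}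

omit [IsFiniteMeasure ((volume : Measure (EuclideanSpace ℝ (Fin d))).restrict Ω)] in
theorem measurableSet_goodSlices (n : ℝ) (u v : L2 Ω T) : MeasurableSet (goodSlices n u v) :=
  ((measurableSet_zeroSet u).union
    (measurableSet_le measurable_const (measurable_norm_slice u))).inter
    (measurableSet_le (measurable_norm_slice v) measurable_const)

omit [IsFiniteMeasure ((volume : Measure (EuclideanSpace ℝ (Fin d))).restrict Ω)] in
theorem eventually_mem_goodSlices (u v : L2 Ω T) (x : EuclideanSpace ℝ (Fin d)) :
    ∀ᶠ k : ℕ in atTop, x ∈ goodSlices ((k : ℝ) + 1) u v := by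
  have hlim : Tendsto (fun k : ℕ => (k : ℝ) + 1) atTop atTop :=
    tendsto_natCast_atTop_atTop.atTop_add tendsto_const_nhds
  refine Eventually.and ?_ (hlim.eventually_ge_atTop _)
  by_cases h0 : slice u x = 0
  · exact Eventually.of_forall fun _ => Or.inl h0
  · filter_upwards [hlim.eventually_ge_atTop (1 / ‖slice u x‖)] with k hk
    exact Or.inr ((one_div_le (norm_pos_iff.2 h0) (by positivity)).1 hk)

/-- The points at which the step `1 / (m + 1)` in the direction `v` is admissible, together with
the slices on which `u` vanishes. -/
def admissiblePoints (α β : ℝ) (m : ℕ) (u v : L2 Ω T) : Set (EuclideanSpace ℝ (Fin d) × ℝ) :=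
  {p | slice u p.1 = 0 ∨
    (α ≤ u p + 1 / ((m : ℝ) + 1) * v p ∧ u p + 1 / ((m : ℝ) + 1) * v p ≤ β)}

omit [IsFiniteMeasure ((volume : Measure (EuclideanSpace ℝ (Fin d))).restrict Ω)] in
theorem measurableSet_admissiblePoints (α β : ℝ) (m : ℕ) (u v : L2 Ω T) :
    MeasurableSet (admissiblePoints α β m u v) := by
  have hm : Measurable fun p => u p + 1 / ((m : ℝ) + 1) * v p :=
    (measurable_coe u).add ((measurable_coe v).const_mul _)
  have h1 : MeasurableSet (Prod.fst ⁻¹' {x | slice u x = 0} :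
      Set (EuclideanSpace ℝ (Fin d) × ℝ)) := measurable_fst (measurableSet_zeroSet u)
  exact h1.union ((measurableSet_le measurable_const hm).inter
    (measurableSet_le hm measurable_const))

theorem mul_quadForm_cut_le {μ : ℝ} (hμ : 0 < μ) {u v : L2 Ω T} (hfin : curvature μ u v ≠ ∞)
    {A : Set (EuclideanSpace ℝ (Fin d))} (hA : MeasurableSet A) :
    μ * quadForm u (cut (hA.prod (MeasurableSet.univ (α := ℝ))) v)
      ≤ (curvature μ u v).toReal := by
  rw [curvature_eq hμ] at hfin ⊢
  have hI : ∫⁻ x in Ω, ENNReal.ofReal (curvForm (slice u x) (slice v x) (slice v x)) ≠ ∞ :=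
    fun h => hfin (by rw [h, ENNReal.mul_top (by simpa using hμ)])
  have hint : Integrable (fun x => curvForm (slice u x) (slice v x) (slice v x))
      (volume.restrict Ω) :=
    (lintegral_ofReal_ne_top_iff_integrable (aemeasurable_curvForm u v v).aestronglyMeasurable
      (ae_of_all _ fun _ => curvForm_self_nonneg _ _)).1 hI
  rw [ENNReal.toReal_mul, ENNReal.toReal_ofReal hμ.le, ← integral_eq_lintegral_of_nonneg_ae
    (ae_of_all _ fun _ => curvForm_self_nonneg _ _) hint.aestronglyMeasurable]
  refine mul_le_mul_of_nonneg_left ?_ hμ.le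
  refine integral_mono_of_nonneg (ae_of_all _ fun _ => curvForm_self_nonneg _ _) hint ?_
  set E := hA.prod (MeasurableSet.univ (α := ℝ))
  filter_upwards [slice_cut_of_mem E v, slice_cut_of_notMem E v] with x h1 h2
  by_cases hx : x ∈ A
  · rw [h1 fun y => ⟨hx, trivial⟩]
  · rw [h2 fun y hy => hx hy.1, curvForm_zero_zero]
    exact curvForm_self_nonneg _ _

/-- A critical direction `v` of finite curvature is approximated in two steps. Truncating to whole
slices makes the second-order expansion uniform and does not increase the curvature; where `u`
vanishes it also makes `v` bounded, as `v` is there a multiple of the bounded subgradient. Cutting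
to the points at which a fixed step is admissible then makes the direction feasible. Both cuts
preserve criticality. -/
theorem approximate_recovery {α β μ M : ℝ} (hα : α < 0) (hβ : 0 < β) (hμ : 0 < μ)
    {u w v : L2 Ω T} (hu : u ∈ Uad Ω T α β) (hw : w ∈ subdiff (G₃ α β μ) u) (hM0 : 0 ≤ M)
    (hM : ∀ᵐ p ∂cylMeasure Ω T, |w p| ≤ M)
    (hv : v ∈ convexTangentCone (Uad Ω T α β) u) (hc : inner ℝ w v = μ * dirDeriv u v)
    (hfin : curvature μ u v ≠ ∞) {ε : ℝ} (hε : 0 < ε) :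
    ∀ᶠ s in 𝓝[>] (0 : ℝ), ∃ g : L2 Ω T, ‖g - v‖ < ε ∧
      secondQuotient (G₃ α β μ) u w s g ≤ (((curvature μ u v).toReal + ε : ℝ) : EReal) := by
  -- first truncation: whole slices
  have hC : ∀ k : ℕ, MeasurableSet (goodSlices ((k : ℝ) + 1) u v ×ˢ (Set.univ : Set ℝ)) :=
    fun k => (measurableSet_goodSlices ((k : ℝ) + 1) u v).prod MeasurableSet.univ
  have hlim1 : Tendsto (fun k : ℕ => cut (hC k) v) atTop (𝓝 v) := by
    refine tendsto_cut hC v (ae_of_all _ fun p => ?_)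
    filter_upwards [eventually_mem_goodSlices u v p.1] with k hk
    exact ⟨hk, trivial⟩
  obtain ⟨k, hk⟩ := ((tendsto_iff_norm_sub_tendsto_zero.1 hlim1).eventually_lt_const
    (half_pos hε)).exists
  set n : ℝ := (k : ℝ) + 1
  have hn : 0 < n := by positivity
  set v₁ := cut (hC k) v
  have hv₁ : v₁ ∈ convexTangentCone (Uad Ω T α β) u := cut_mem_convexTangentCone hu hv _
  have hc₁ : inner ℝ w v₁ = μ * dirDeriv u v₁ := by
    refine inner_cut_eq hu hw hv hc _ fun x _ => ?_
    by_cases hx : x ∈ goodSlices n u v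
    · exact Or.inl fun y => ⟨hx, trivial⟩
    · exact Or.inr fun y hy => hx hy.1
  have hslice : ∀ᵐ x ∂(volume.restrict Ω), (x ∈ goodSlices n u v ∧ slice v₁ x = slice v x) ∨
      slice v₁ x = 0 := by
    filter_upwards [slice_cut_of_mem (hC k) v, slice_cut_of_notMem (hC k) v] with x h1 h2
    by_cases hx : x ∈ goodSlices n u v
    · exact Or.inl ⟨hx, h1 fun y => ⟨hx, trivial⟩⟩
    · exact Or.inr (h2 fun y hy => hx hy.1)
  have ha₁ : AwayFromZero n u v₁ := by
    filter_upwards [hslice] with x h1 h2 h3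
    exact (h1.resolve_right h3).1.1.resolve_left h2
  have hb₁ : ∀ᵐ x ∂(volume.restrict Ω), ‖slice v₁ x‖ ≤ n := by
    filter_upwards [hslice] with x h1
    rcases h1 with h1 | h1
    · rw [h1.2]; exact h1.1.2
    · rw [h1, norm_zero]; exact hn.le
  -- second truncation: points at which a fixed step is admissible
  have hE := fun m : ℕ => measurableSet_admissiblePoints α β m u v
  have hlim2 : Tendsto (fun m : ℕ => cut (hE m) v₁) atTop (𝓝 v₁) := by
    refine tendsto_cut hE v₁ ?_
    filter_upwards [eventually_admissible hu hv] with p hp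
    exact hp.mono fun m hm => Or.inr hm
  obtain ⟨m, hm1, hm2⟩ := (((tendsto_iff_norm_sub_tendsto_zero.1 hlim2).eventually_lt_const
    (half_pos hε)).and (tendsto_quadForm_cut hn ha₁ hE hlim2 (ε := ε / μ) (by positivity))).exists
  set g := cut (hE m) v₁
  have hcg : inner ℝ w g = μ * dirDeriv u g :=
    inner_cut_eq hu hw hv₁ hc₁ _ fun x hx => Or.inl fun y => Or.inl hx
  have hbg : ∀ᵐ x ∂(volume.restrict Ω), ‖slice g x‖ ≤ n := by
    filter_upwards [hb₁, norm_slice_cut_le (hE m) v₁] with x h1 h2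
    exact h2.trans h1
  have hfg : g ∈ feasibleCone (Uad Ω T α β) u := by
    refine mem_feasibleCone hα hβ hu (s := 1 / ((m : ℝ) + 1)) (M := n / μ * M) (by positivity)
      (by positivity) ?_
    filter_upwards [hu, cut_coe (hE m) v₁, cut_coe (hC k) v, ae_eq_zero_of_slice_eq_zero u, hM,
      ae_eq_smul_subgradient hα hβ hμ hu hw hM0 hM hv hc] with p h1 h2 h3 h4 h5 h6
    rw [h2]
    by_cases hpE : p ∈ admissiblePoints α β m u v
    swap
    · rw [Set.indicator_of_notMem hpE]
      exact Or.inr (by simpa using h1)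
    rw [Set.indicator_of_mem hpE, h3]
    by_cases hpC : p ∈ goodSlices n u v ×ˢ (Set.univ : Set ℝ)
    swap
    · rw [Set.indicator_of_notMem hpC]
      exact Or.inr (by simpa using h1)
    rw [Set.indicator_of_mem hpC]
    by_cases h0 : slice u p.1 = 0
    · refine Or.inl ⟨h4 h0, ?_⟩
      rw [h6 h0, abs_mul, abs_of_nonneg (by positivity)]
      have := hpC.1.2
      gcongr
    · exact Or.inr (hpE.resolve_left h0)
  have hq : μ * quadForm u g < (curvature μ u v).toReal + ε := by
    have h1 : μ * quadForm u v₁ ≤ (curvature μ u v).toReal :=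
      mul_quadForm_cut_le hμ hfin (measurableSet_goodSlices n u v)
    have h2 := mul_lt_mul_of_pos_left hm2 hμ
    rw [mul_add, mul_div_cancel₀ _ hμ.ne'] at h2
    linarith
  have hdist : ‖g - v‖ < ε := by
    calc ‖g - v‖ ≤ ‖g - v₁‖ + ‖v₁ - v‖ := norm_sub_le_norm_sub_add_norm_sub _ _ _
      _ < ε / 2 + ε / 2 := add_lt_add hm1 hk
      _ = ε := add_halves ε
  filter_upwards [eventually_secondQuotient_le hμ hu hfg hcg hn (ha₁.cut (hE m)) hbg hq] with s hs
  exact ⟨g, hdist, hs⟩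

/-- In critical directions the weak second subderivative is the curvature, and a strongly
convergent recovery sequence exists. -/
theorem secondSubderiv_eq_curvature {α β μ M : ℝ} (hα : α < 0) (hβ : 0 < β) (hμ : 0 < μ)
    {u w v : L2 Ω T} (hu : u ∈ Uad Ω T α β) (hw : w ∈ subdiff (G₃ α β μ) u) (hM0 : 0 ≤ M)
    (hM : ∀ᵐ p ∂cylMeasure Ω T, |w p| ≤ M)
    (hv : v ∈ convexTangentCone (Uad Ω T α β) u) (hc : inner ℝ w v = μ * dirDeriv u v) :
    secondSubderiv (G₃ α β μ) u w v = (curvature μ u v : EReal) ∧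
      StronglyTwiceEpiDiffInDir (G₃ α β μ) u w v :=
  secondSubderiv_eq_of_bounds (fun _ _ ht hvs => curvature_le_liminf hμ hu hw ht hvs)
    fun hfin _ hε => approximate_recovery hα hβ hμ hu hw hM0 hM hv hc hfin hε

/-- In the other directions the weak second subderivative is `∞`, and constant sequences are
recovery sequences. -/
theorem stronglyTwiceEpiDiffInDir_of_not_critical {α β μ : ℝ} (hμ : 0 < μ)
    {u w v : L2 Ω T} (hu : u ∈ Uad Ω T α β) (hw : w ∈ subdiff (G₃ α β μ) u)
    (hv : ¬(v ∈ convexTangentCone (Uad Ω T α β) u ∧ inner ℝ w v = μ * dirDeriv u v)) :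
    StronglyTwiceEpiDiffInDir (G₃ α β μ) u w v := by
  have key : ∀ (t : ℕ → ℝ) (vs : ℕ → L2 Ω T), StepsToZero t → WeakConv vs v →
      Tendsto (fun k => secondQuotient (G₃ α β μ) u w (t k) (vs k)) atTop (𝓝 ⊤) := by
    intro t vs ht hvs
    rw [EReal.tendsto_nhds_top_iff_real]
    intro C
    by_contra hn
    refine hv (critical_of_frequently_le hμ hu hw ht hvs (C := C) ?_)
    simpa only [not_eventually, not_lt] using hn
  have hval : secondSubderiv (G₃ α β μ) u w v = ⊤ := by
    refine sInf_eq_top.2 ?_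
    rintro q ⟨t, vs, ht, hvs, rfl⟩
    exact (key t vs ht hvs).liminf_eq
  intro t ht
  rw [hval]
  exact ⟨fun _ => v, tendsto_const_nhds, key t _ ht (weakConv_of_tendsto tendsto_const_nhds)⟩

theorem curvature_zero {μ : ℝ} (hμ : 0 < μ) (v : L2 Ω T) : curvature μ 0 v = 0 := by
  rw [curvature_eq hμ, lintegral_eq_zero_of_ae_eq_zero, mul_zero]
  filter_upwards [slice_smul 0 (0 : L2 Ω T)] with x hx
  rw [zero_smul, zero_smul] at hx
  rw [hx, curvForm_zero_left, ENNReal.ofReal_zero, Pi.zero_apply]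

end Recovery

end SparseControl

theorem theoremG3 {d : ℕ} (Ω : Set (EuclideanSpace ℝ (Fin d)))
    (hΩo : IsOpen Ω) (hΩn : Ω.Nonempty) (hΩb : Bornology.IsBounded Ω)
    (T : ℝ) (hT : 0 < T) (α β μ : ℝ) (hα : α < 0) (hβ : 0 < β) (hμ : 0 < μ)
    (u : L2 Ω T) (hu : u ∈ Uad Ω T α β)
    (F : L2 Ω T → ℝ) (F' : L2 Ω T) (F'' : L2 Ω T →L[ℝ] L2 Ω T →L[ℝ] ℝ)
    (hF : HasTaylorExpansion (Uad Ω T α β) F u F' F'')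
    (hsub : -F' ∈ subdiff (G₃ α β μ) u)
    (hbdd : MemLp (⇑(-F')) ∞ (cylMeasure Ω T)) :
    (∀ v ∈ criticalCone α β μ u F',
      (u ≠ 0 → secondSubderiv (G₃ α β μ) u (-F') v = (curvature μ u v : EReal)) ∧
      (u = 0 → secondSubderiv (G₃ α β μ) u (-F') v = 0)) ∧
    StronglyTwiceEpiDiff (G₃ α β μ) u (-F') := by
  have : IsFiniteMeasure ((volume : Measure (EuclideanSpace ℝ (Fin d))).restrict Ω) :=
    ⟨by simpa using hΩb.measure_lt_top⟩
  obtain ⟨M, hM0, hM⟩ : ∃ M : ℝ, 0 ≤ M ∧ ∀ᵐ p ∂cylMeasure Ω T, |(-F' : L2 Ω T) p| ≤ M := by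
    have htop : eLpNormEssSup (⇑(-F')) (cylMeasure Ω T) ≠ ∞ := by
      simpa using hbdd.2.ne
    refine ⟨(eLpNormEssSup (⇑(-F')) (cylMeasure Ω T)).toReal, ENNReal.toReal_nonneg, ?_⟩
    filter_upwards [ae_le_eLpNormEssSup (f := ⇑(-F')) (μ := cylMeasure Ω T)] with p hp
    have := ENNReal.toReal_mono htop hp
    simpa using this
  have hcrit := fun (v : L2 Ω T) hv hc =>
    secondSubderiv_eq_curvature (v := v) hα hβ hμ hu hsub hM0 hM hv hc
  refine ⟨fun v hv => ?_, fun v => ?_⟩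
  · obtain ⟨h1, h2⟩ := mem_criticalCone_iff.1 hv
    refine ⟨fun _ => (hcrit v h1 h2).1, fun h0 => ?_⟩
    rw [(hcrit v h1 h2).1, h0, curvature_zero hμ, EReal.coe_ennreal_zero]
  · by_cases hv : v ∈ convexTangentCone (Uad Ω T α β) u ∧ inner ℝ (-F') v = μ * dirDeriv u v
    · exact (hcrit v hv.1 hv.2).2
    · exact stronglyTwiceEpiDiffInDir_of_not_critical hμ hu hsub hv
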